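/- Let $\mathcal J$ be a set (of sorts), let $\mathcal J^{<\mathbb N}$ be the set of tuples of elements of $\mathcal J$ of finite length $n\ge 1$, and fix an arbitrary function $J^*_{\subset}:\mathbb N_{\ge 1}\times\mathcal J^{<\mathbb N}\to\mathcal J^{<\mathbb N}$. For a tuple $J$ let $\|J\|$ be its set of entries, and let $\sqrt J=\{J'\in\mathcal J^{<\mathbb N}:\|J\|\subseteq\|J'\|\}$. For a profinite group $G$ let $\mathcal N(G)$ be the set of its open normal subgroups. A *sorting data* on $G$ is a family $F=(F(N))_{N\in\mathcal N(G)}$ of non-empty subsets of $\mathcal J^{<\mathbb N}$ such that for all $N,N_1,N_2\in\mathcal N(G)$: 1. $F(G)=\mathcal J^{<\mathbb N}$; 2. $J\in F(N)\iff\sqrt J\subseteq F(N)$; 3. $J\in F(N)\iff J'\in F(N)$ whenever $J'$ is a permutation of $J$; 4. if $N_1\subseteq N_2$, $[G:N_1]\le k$ and $J\in F(N_1)$, then $J^*_{\subset}(k,J)\in F(N_2)$; 5. if $J_1\in F(N_1)$ and $J_2\in F(N_2)$, then the concatenation $J_1{}^\frown J_2$ is in $F(N_1\cap N_2)$; 6.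 if $g\in G$ and $g^{-1}N_1g=N_2$, then $F(N_1)=F(N_2)$. A *sorted profinite group* is such a pair $(G,F)$. A *morphism* $f:(G_1,F_1)\to(G_2,F_2)$ is a continuous surjective homomorphism $f:G_1\to G_2$ with $F_2(N)\subseteq F_1(f^{-1}[N])$ for all $N\in\mathcal N(G_2)$. Call the resulting category $\mathrm{SPG}_{\mathcal J}$. A *finite quotient* of $(G,F)$ is a sorted profinite group $(A,F_A)$ with $A$ finite for which there is a morphism $(G,F)\to(A,F_A)$. The *fibre product* of morphisms $\Pi_i:(B_i,F_i)\to(A,F_A)$, $i=1,2$, is the group $B_1\times_AB_2$ with the smallest sorting data for which both projections are morphisms. *Inverse limits* are limits in $\mathrm{SPG}_{\mathcal J}$ of inverse systems indexed by non-empty directed posets. $(G,F)$ has the *sorted embedding property* (SEP) if for all finite quotients $(A,F_A)$, $(B,F_B)$ of $(G,F)$ and all morphisms $\Pi:(A,F_A)\to(B,F_B)$, $\varphi:(G,F)\to(B,F_B)$ there is a morphism $\psi:(G,F)\to(A,F_A)$ with $\Pi\circ\psi=\varphi$. A *SEP-cover* of $(G,F)$ is a morphism $(H,F_H)\to(G,F)$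 such that $(H,F_H)$ has SEP. A SEP-cover $p:(H,F_H)\to(G,F)$ is *universal* if for every SEP-cover $r:(H',F_{H'})\to(G,F)$ there is a morphism $q:(H',F_{H'})\to(H,F_H)$ with $p\circ q=r$. For a full subcategory $\mathcal C$ of $\mathrm{SPG}_{\mathcal J}$, a SEP-cover $p:(H,F_H)\to(G,F)$ is *universal in $\mathcal C$* if $(H,F_H)\in\mathcal C$ and the factorization property holds for all SEP-covers $r$ with source in $\mathcal C$. **Theorem.** (a) Every sorted profinite group $(G,F)$ has a universal SEP-cover. If moreover $G$ is (topologically) finitely generated, the universal SEP-cover is unique up to isomorphism: for any two universal SEP-covers $p_i:(H_i,F_{H_i})\to(G,F)$, $i=1,2$, there is an isomorphism $e:(H_1,F_{H_1})\to(H_2,F_{H_2})$ with $p_2\circ e=p_1$. (b) Let $\mathcal C$ be a full subcategory of $\mathrm{SPG}_{\mathcal J}$ (closed under isomorphism) that is closed under finite quotients, fibre products (of morphisms $B_1\to A\leftarrow B_2$ in $\mathcal C$) and inverse limits. Then every $(G,F)\in\mathcal C$ has a universal SEP-cover $(H,F_H)\to(G,F)$ with $(H,F_H)\in\mathcal C$;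 in particular it is also universal in $\mathcal C$. If moreover $G$ is finitely generated, then any two SEP-covers of $(G,F)$ that are universal in $\mathcal C$ are isomorphic over $(G,F)$. -/

import Mathlib

open CategoryTheory

universe u v

/-- The set `𝒥^{<ℕ}` of non-empty finite tuples of sorts (tuples of length `n ≥ 1`). -/
abbrev SortTuple (𝒥 : Type v) : Type v := {l : List 𝒥 // l ≠ []}

namespace SortTuple

variable {𝒥 : Type v}

/-- The support `‖J‖` of a tuple. -/
def supp (J : SortTuple 𝒥) : Set 𝒥 := {s | s ∈ J.1}

/-- The concatenation of two tuples. -/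
def concat (J J' : SortTuple 𝒥) : SortTuple 𝒥 :=
  ⟨J.1 ++ J'.1, fun h => J.2 (List.append_eq_nil_iff.mp h).1⟩

/-- `√J`: the tuples in which every sort of `J` occurs. -/
def radical (J : SortTuple 𝒥) : Set (SortTuple 𝒥) := {J' | J.supp ⊆ J'.supp}

end SortTuple

/-- The preimage of an open normal subgroup under a continuous homomorphism. -/
def OpenNormalSubgroup.preimage {G H : Type u} [Group G] [TopologicalSpace G] [Group H]
    [TopologicalSpace H] (f : G →ₜ* H) (N : OpenNormalSubgroup H) : OpenNormalSubgroup G where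
  toOpenSubgroup := N.toOpenSubgroup.comap f.toMonoidHom f.continuous_toFun
  isNormal' := N.isNormal'.comap f.toMonoidHom

/-- A sorting data on a (profinite) group `G`, with respect to a fixed function
`Jsub : ℕ × 𝒥^{<ℕ} → 𝒥^{<ℕ}`. Only the values of `Jsub` at `k ≥ 1` matter, since
`[G : N₁] ≥ 1` for an open subgroup `N₁` of a profinite group. -/
@[ext]
structure SortingData {𝒥 : Type v} (Jsub : ℕ → SortTuple 𝒥 → SortTuple 𝒥)
    (G : Type u) [Group G] [TopologicalSpace G] where
  /-- The set of tuples attached to an open normal subgroup. -/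
  sorts : OpenNormalSubgroup G → Set (SortTuple 𝒥)
  nonempty : ∀ N, (sorts N).Nonempty
  whole : ∀ N : OpenNormalSubgroup G, (N : Subgroup G) = ⊤ → sorts N = Set.univ
  radical_iff : ∀ N J, J ∈ sorts N ↔ J.radical ⊆ sorts N
  perm_iff : ∀ N (J J' : SortTuple 𝒥), J.1.Perm J'.1 → (J ∈ sorts N ↔ J' ∈ sorts N)
  mono : ∀ (N₁ N₂ : OpenNormalSubgroup G) (k : ℕ) (J : SortTuple 𝒥), N₁ ≤ N₂ →
    (N₁ : Subgroup G).index ≤ k → J ∈ sorts N₁ → Jsub k J ∈ sorts N₂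
  inter : ∀ (N₁ N₂ : OpenNormalSubgroup G) (J₁ J₂ : SortTuple 𝒥),
    J₁ ∈ sorts N₁ → J₂ ∈ sorts N₂ → J₁.concat J₂ ∈ sorts (N₁ ⊓ N₂)
  conj : ∀ (N₁ N₂ : OpenNormalSubgroup G) (g : G),
    (N₂ : Set G) = (fun x => g⁻¹ * x * g) '' (N₁ : Set G) → sorts N₁ = sorts N₂

/-- A sorted profinite group with sorts from `𝒥`. -/
structure SortedProfiniteGrp {𝒥 : Type v} (Jsub : ℕ → SortTuple 𝒥 → SortTuple 𝒥) where
  /-- The underlying profinite group. -/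
  grp : ProfiniteGrp.{u}
  /-- The sorting data. -/
  data : SortingData Jsub grp

namespace SortedProfiniteGrp

variable {𝒥 : Type v} {Jsub : ℕ → SortTuple 𝒥 → SortTuple 𝒥}

/-- A morphism `(G₁, F₁) → (G₂, F₂)`: a continuous epimorphism `f : G₁ → G₂` such that
`F₂(N) ⊆ F₁(f⁻¹[N])` for all open normal subgroups `N` of `G₂`. -/
@[ext]
structure Hom (X Y : SortedProfiniteGrp.{u} Jsub) where
  /-- The underlying continuous homomorphism. -/
  map : X.grp →ₜ* Y.grp
  surjective : Function.Surjective map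
  sorted : ∀ N, Y.data.sorts N ⊆ X.data.sorts (N.preimage map)

/-- The category of sorted profinite groups; all its morphisms are epimorphisms of groups. -/
instance : Category (SortedProfiniteGrp.{u} Jsub) where
  Hom := Hom
  id X := ⟨ContinuousMonoidHom.id X.grp, Function.surjective_id, fun _ => Set.Subset.rfl⟩
  comp f g := ⟨g.map.comp f.map, g.surjective.comp f.surjective,
    fun N => (g.sorted N).trans (f.sorted (N.preimage g.map))⟩

/-- The sorted embedding property: for all finite quotients `(A, F_A)`, `(B, F_B)` of `(G, F)` and
all morphisms `π : (A, F_A) → (B, F_B)`, `φ : (G, F) → (B, F_B)` there is a morphism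
`ψ : (G, F) → (A, F_A)` with `π ∘ ψ = φ`. -/
def HasSEP (X : SortedProfiniteGrp.{u} Jsub) : Prop :=
  ∀ A B : SortedProfiniteGrp.{u} Jsub, Finite A.grp → Finite B.grp →
    Nonempty (X ⟶ A) → Nonempty (X ⟶ B) →
    ∀ (π : A ⟶ B) (φ : X ⟶ B), ∃ ψ : X ⟶ A, ψ ≫ π = φ

/-- A morphism is a SEP-cover if its source has the sorted embedding property. -/
def IsSEPCover {Y X : SortedProfiniteGrp.{u} Jsub} (_p : Y ⟶ X) : Prop := Y.HasSEP

/-- A universal SEP-cover: a SEP-cover through which every SEP-cover of the same group factors. -/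
def IsUniversalSEPCover {Y X : SortedProfiniteGrp.{u} Jsub} (p : Y ⟶ X) : Prop :=
  IsSEPCover p ∧ ∀ (Z : SortedProfiniteGrp.{u} Jsub) (r : Z ⟶ X), IsSEPCover r →
    ∃ q : Z ⟶ Y, q ≫ p = r

/-- A universal SEP-cover within the full subcategory `𝒞`: its source lies in `𝒞`, and the
factorization property is required for SEP-covers with source in `𝒞`. -/
def IsUniversalSEPCoverIn (𝒞 : ObjectProperty (SortedProfiniteGrp.{u} Jsub))
    {Y X : SortedProfiniteGrp.{u} Jsub} (p : Y ⟶ X) : Prop :=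
  𝒞 Y ∧ IsSEPCover p ∧ ∀ (Z : SortedProfiniteGrp.{u} Jsub) (r : Z ⟶ X), 𝒞 Z → IsSEPCover r →
    ∃ q : Z ⟶ Y, q ≫ p = r

/-- The square `p₁ ≫ π₁ = p₂ ≫ π₂` exhibits `B` as the fibre product of `B₁` and `B₂` over `A`:
the group is the fibre product of groups, and its sorting data is the smallest one for which both
projections are sorted. -/
structure IsFibreProduct {A B₁ B₂ B : SortedProfiniteGrp.{u} Jsub} (π₁ : B₁ ⟶ A) (π₂ : B₂ ⟶ A)
    (p₁ : B ⟶ B₁) (p₂ : B ⟶ B₂) : Prop where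
  comm : p₁ ≫ π₁ = p₂ ≫ π₂
  existsUnique : ∀ b₁ b₂, π₁.map b₁ = π₂.map b₂ → ∃! b, p₁.map b = b₁ ∧ p₂.map b = b₂
  minimal : ∀ F : SortingData Jsub B.grp,
    (∀ N, B₁.data.sorts N ⊆ F.sorts (N.preimage p₁.map)) →
    (∀ N, B₂.data.sorts N ⊆ F.sorts (N.preimage p₂.map)) →
    ∀ N, B.data.sorts N ⊆ F.sorts N

/-- The full subcategory `𝒞` is closed under finite quotients. -/
def ClosedUnderFiniteQuotients (𝒞 : ObjectProperty (SortedProfiniteGrp.{u} Jsub)) : Prop :=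
  ∀ (X A : SortedProfiniteGrp.{u} Jsub) (_ : X ⟶ A), 𝒞 X → Finite A.grp → 𝒞 A

/-- The full subcategory `𝒞` is closed under fibre products. -/
def ClosedUnderFibreProducts (𝒞 : ObjectProperty (SortedProfiniteGrp.{u} Jsub)) : Prop :=
  ∀ (A B₁ B₂ B : SortedProfiniteGrp.{u} Jsub) (π₁ : B₁ ⟶ A) (π₂ : B₂ ⟶ A)
    (p₁ : B ⟶ B₁) (p₂ : B ⟶ B₂), 𝒞 A → 𝒞 B₁ → 𝒞 B₂ → IsFibreProduct π₁ π₂ p₁ p₂ → 𝒞 B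

/-- The full subcategory `𝒞` is closed under inverse limits of inverse systems of sorted profinite
groups indexed by (non-empty) directed posets. -/
def ClosedUnderInverseLimits (𝒞 : ObjectProperty (SortedProfiniteGrp.{u} Jsub)) : Prop :=
  ∀ (I : Type (max u v)) [PartialOrder I] [IsDirectedOrder I] [Nonempty I],
    𝒞.IsClosedUnderLimitsOfShape Iᵒᵖ

/-- `G` is finitely generated as a profinite group: a finite set generates a dense subgroup. -/
def IsFinitelyGenerated (X : SortedProfiniteGrp.{u} Jsub) : Prop :=
  ∃ S : Finset X.grp, Dense ((Subgroup.closure (S : Set X.grp) : Subgroup X.grp) : Set X.grp)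

end SortedProfiniteGrp

/-! Every sorted profinite group `X` is a quotient of a free profinite group `E` on infinitely many
generators with the largest sorting data. For such `E` the sorted embedding property says that
generating families lift along epimorphisms of finite groups. Sorted quotients of `E` correspond to
`PartialSortingData` on `E`, where empty values are allowed and the subgroups with non-empty value
cut out the kernel. In this poset suitable suprema are fibre products (`isFibreProduct_sup`) and
directed unions are inverse limits (`prop_directedUnion`), so the closure properties of `𝒞` apply.

Existence: Zorn's lemma gives a maximal quotient of `E` over `X` to which all morphisms `Z ⟶ X` with
`Z` having SEP lift, with compatibly chosen lifts (`Stage`). Were it without SEP, take an unsolvable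
embedding problem `A ⟶ B` whose kernel has least order. If it has no solution even as plain groups,
minimality forces compatible epimorphisms to cover the fibre product over `B`
(`exists_of_minimal_embedding_problem`), and solutions for `E` and `Z` give a larger quotient to
which `Z` still lifts. If an unsorted solution exists, only the sorting data has to grow, and
`HasSEP.sorts_preimage_subset` keeps the maps from `Z` sorted. Both cases contradict maximality
(`exists_isCoverStep`).

Uniqueness: by Gaschütz' lemma free groups of finite rank also have SEP, so one of them maps onto
the universal cover, which is then finitely generated and Hopfian. Universal covers map onto each
other, these maps are injective, and SEP makes the sorting data agree. -/

/-! ### Factorization, lifting and quotients for compact groups. -/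

section ProfiniteLemmas

variable {E Q P Z : Type*} [Group E] [TopologicalSpace E] [Group Q] [TopologicalSpace Q]
  [Group P] [TopologicalSpace P] [Group Z] [TopologicalSpace Z]

/-- A continuous homomorphism lifts along an injective one with compact source as soon as it
lifts pointwise. -/
theorem ContinuousMonoidHom.exists_lift_of_injective [CompactSpace Q] [T2Space P]
    (f : Q →ₜ* P) (hf : Function.Injective f) (g : Z →ₜ* P) (h : ∀ z, ∃ q, f q = g z) :
    ∃ l : Z →ₜ* Q, ∀ z, f (l z) = g z := by
  choose l hl using h
  have hemb : Topology.IsClosedEmbedding f := f.continuous_toFun.isClosedEmbedding hf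
  refine ⟨⟨⟨⟨l, hf ?_⟩, fun x y => hf ?_⟩, ?_⟩, hl⟩
  · rw [hl, map_one, map_one]
  · rw [map_mul, hl, hl, hl, map_mul]
  · refine hemb.isInducing.continuous_iff.mpr ?_
    exact g.continuous_toFun.congr fun z => (hl z).symm

/-- A continuous homomorphism factors through a surjective one with larger kernel. -/
theorem ContinuousMonoidHom.exists_factor [CompactSpace E] [T2Space Q]
    (f : E →ₜ* Q) (hf : Function.Surjective f) (g : E →ₜ* P)
    (h : ∀ x, f x = 1 → g x = 1) : ∃ k : Q →ₜ* P, ∀ x, k (f x) = g x := by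
  have key : ∀ x y, f x = f y → g x = g y := fun x y hxy => by
    have := h (x * y⁻¹) (by rw [map_mul, map_inv, hxy, mul_inv_cancel])
    rwa [map_mul, map_inv, mul_inv_eq_one] at this
  choose s hs using hf
  have hk : ∀ x, g (s (f x)) = g x := fun x => key _ _ (hs _)
  have hq : Topology.IsQuotientMap f :=
    (f.continuous_toFun.isClosedMap).isQuotientMap f.continuous_toFun fun q => ⟨s q, hs q⟩
  refine ⟨⟨⟨⟨fun q => g (s q), ?_⟩, fun a b => ?_⟩, ?_⟩, hk⟩
  · rw [← map_one f, hk, map_one]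
  · rw [← map_mul]
    exact key _ _ (by rw [hs, map_mul, hs, hs])
  · refine hq.continuous_iff.mpr ?_
    exact g.continuous_toFun.congr fun x => (hk x).symm

theorem ContinuousMonoidHom.isOpenMap_of_surjective [IsTopologicalGroup E] [CompactSpace E]
    [T2Space Q] (f : E →ₜ* Q) (hf : Function.Surjective f) : IsOpenMap f := by
  have hq : Topology.IsQuotientMap f :=
    (f.continuous_toFun.isClosedMap).isQuotientMap f.continuous_toFun hf
  exact (MonoidHom.isOpenQuotientMap_of_isQuotientMap (φ := f) hq).isOpenMap

/-- If `x ∉ K` with `K` closed, some open normal `N` has `xN` disjoint from `K`. The image of `N` is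
then an open subgroup missing the class of `x`, and translates of such clopen subgroups separate
points. -/
theorem QuotientGroup.totallyDisconnectedSpace [IsTopologicalGroup E] [CompactSpace E]
    [TotallyDisconnectedSpace E] (K : Subgroup E) [K.Normal] (hK : IsClosed (K : Set E)) :
    TotallyDisconnectedSpace (E ⧸ K) := by
  have key : ∀ q : E ⧸ K, q ≠ 1 → ∃ H : OpenSubgroup (E ⧸ K), q ∉ H := by
    intro q hq
    obtain ⟨x, rfl⟩ := QuotientGroup.mk_surjective q
    have hx : x ∉ K := fun h => hq ((QuotientGroup.eq_one_iff x).mpr h)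
    obtain ⟨N, hN⟩ := ProfiniteGrp.exist_openNormalSubgroup_sub_open_nhds_of_one
      (U := (fun g => x * g) ⁻¹' (K : Set E)ᶜ)
      (hK.isOpen_compl.preimage (continuous_const.mul continuous_id)) (by simpa using hx)
    refine ⟨⟨(N : Subgroup E).map (QuotientGroup.mk' K),
      QuotientGroup.isOpenMap_coe _ N.isOpen'⟩, ?_⟩
    rintro ⟨n, hn, hnx⟩
    have h1 : n⁻¹ * x ∈ K := QuotientGroup.eq.mp hnx
    have h2 : x * n⁻¹ ∈ K := by
      have := ‹K.Normal›.conj_mem _ h1 n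
      simpa using this
    exact hN (inv_mem hn : n⁻¹ ∈ (N : Subgroup E)) h2
  have : TotallySeparatedSpace (E ⧸ K) := by
    refine totallySeparatedSpace_iff_exists_isClopen.mpr fun x y hxy => ?_
    obtain ⟨H, hH⟩ := key (x⁻¹ * y) (by rwa [Ne, inv_mul_eq_one])
    refine ⟨(fun z => x⁻¹ * z) ⁻¹' H, H.isClopen.preimage (continuous_const.mul continuous_id),
      ?_, hH⟩
    simp
  infer_instance

/-- In a compact group, an open set containing the intersection of a directed family of closed
subgroups contains one of them. -/
theorem Subgroup.exists_le_of_iInf_le [CompactSpace E] {ι : Type*} [Nonempty ι]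
    (N : ι → Subgroup E) (hdir : Directed (· ≥ ·) N) (hcl : ∀ i, IsClosed (N i : Set E))
    {U : Set E} (hU : IsOpen U) (h : ∀ x, (∀ i, x ∈ N i) → x ∈ U) :
    ∃ i, (N i : Set E) ⊆ U := by
  have := exists_subset_nhds_of_isCompact' (V := fun i => (N i : Set E)) hdir
    (fun i => (hcl i).isCompact) hcl (U := U)
    (fun x hx => hU.mem_nhds (h x (by simpa using hx)))
  exact this

end ProfiniteLemmas

/-! ### Open normal subgroups under epimorphisms. -/

section OpenNormalSubgroups

variable {E Q : Type u} [Group E] [TopologicalSpace E] [Group Q] [TopologicalSpace Q]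

/-- The image of an open normal subgroup under an open epimorphism. -/
def OpenNormalSubgroup.image (f : E →ₜ* Q) (hf : Function.Surjective f) (ho : IsOpenMap f)
    (N : OpenNormalSubgroup E) : OpenNormalSubgroup Q where
  toSubgroup := (N : Subgroup E).map f.toMonoidHom
  isOpen' := ho _ N.isOpen'
  isNormal' := N.isNormal'.map f.toMonoidHom hf

@[simp]
theorem OpenNormalSubgroup.mem_preimage (f : E →ₜ* Q) (N : OpenNormalSubgroup Q) (x : E) :
    x ∈ N.preimage f ↔ f x ∈ N := Iff.rfl

theorem OpenNormalSubgroup.preimage_image (f : E →ₜ* Q) (hf : Function.Surjective f)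
    (ho : IsOpenMap f) (N : OpenNormalSubgroup E) (h : ∀ x, f x = 1 → x ∈ N) :
    (N.image f hf ho).preimage f = N := by
  refine SetLike.ext fun x => ⟨?_, fun hx => Subgroup.mem_map_of_mem f.toMonoidHom hx⟩
  rintro ⟨y, hy, hyx⟩
  have : f (y⁻¹ * x) = 1 := by
    rw [map_mul, map_inv, inv_mul_eq_one]; exact hyx
  simpa using mul_mem (show y ∈ N from hy) (h _ this)

theorem OpenNormalSubgroup.preimage_injective (f : E →ₜ* Q) (hf : Function.Surjective f) :
    Function.Injective fun N : OpenNormalSubgroup Q => N.preimage f := by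
  intro N M h
  refine SetLike.ext fun q => ?_
  obtain ⟨x, rfl⟩ := hf q
  exact SetLike.ext_iff.mp h x

theorem OpenNormalSubgroup.index_preimage (f : E →ₜ* Q) (hf : Function.Surjective f)
    (N : OpenNormalSubgroup Q) :
    (N.preimage f : Subgroup E).index = (N : Subgroup Q).index :=
  Subgroup.index_comap_of_surjective (N : Subgroup Q) (f := f.toMonoidHom) hf

theorem OpenNormalSubgroup.preimage_eq_top_iff (f : E →ₜ* Q) (hf : Function.Surjective f)
    (N : OpenNormalSubgroup Q) :
    (N.preimage f : Subgroup E) = ⊤ ↔ (N : Subgroup Q) = ⊤ := by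
  rw [← Subgroup.index_eq_one, index_preimage f hf, Subgroup.index_eq_one]

theorem OpenNormalSubgroup.preimage_mono (f : E →ₜ* Q) {N M : OpenNormalSubgroup Q} (h : N ≤ M) :
    N.preimage f ≤ M.preimage f := fun _ hx => h hx

end OpenNormalSubgroups

namespace SortTuple

variable {𝒥 : Type v}

theorem supp_concat (J J' : SortTuple 𝒥) : (J.concat J').supp = J.supp ∪ J'.supp := by
  ext s
  simp [supp, concat]

theorem supp_eq_of_perm {J J' : SortTuple 𝒥} (h : J.1.Perm J'.1) : J.supp = J'.supp := by
  ext s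
  exact h.mem_iff

end SortTuple

/-! ### The poset of partial sorting data. -/

/-- A sorting data whose values may be empty. On a profinite group `E` this amounts to a sorting
data on a quotient of `E`: the quotient by the intersection of the subgroups with non-empty
value. -/
@[ext]
structure PartialSortingData {𝒥 : Type v} (Jsub : ℕ → SortTuple 𝒥 → SortTuple 𝒥)
    (E : Type u) [Group E] [TopologicalSpace E] where
  /-- The set of tuples attached to an open normal subgroup. -/
  sorts : OpenNormalSubgroup E → Set (SortTuple 𝒥)
  whole : ∀ N : OpenNormalSubgroup E, (N : Subgroup E) = ⊤ → sorts N = Set.univ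
  upward : ∀ N (J J' : SortTuple 𝒥), J.supp ⊆ J'.supp → J ∈ sorts N → J' ∈ sorts N
  mono : ∀ (N₁ N₂ : OpenNormalSubgroup E) (k : ℕ) (J : SortTuple 𝒥), N₁ ≤ N₂ →
    (N₁ : Subgroup E).index ≤ k → J ∈ sorts N₁ → Jsub k J ∈ sorts N₂
  inter : ∀ (N₁ N₂ : OpenNormalSubgroup E) (J₁ J₂ : SortTuple 𝒥),
    J₁ ∈ sorts N₁ → J₂ ∈ sorts N₂ → J₁.concat J₂ ∈ sorts (N₁ ⊓ N₂)

namespace SortingData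

variable {𝒥 : Type v} {Jsub : ℕ → SortTuple 𝒥 → SortTuple 𝒥}
  {G Q : Type u} [Group G] [TopologicalSpace G] [Group Q] [TopologicalSpace Q]

/-- Forget that the values of a sorting data are non-empty. -/
def toPartial (F : SortingData Jsub G) : PartialSortingData Jsub G where
  sorts := F.sorts
  whole := F.whole
  upward N J _ hJ h := (F.radical_iff N J).mp h hJ
  mono := F.mono
  inter := F.inter

end SortingData

namespace PartialSortingData

variable {𝒥 : Type v} {Jsub : ℕ → SortTuple 𝒥 → SortTuple 𝒥}

section Basic

variable {E Q : Type u} [Group E] [TopologicalSpace E] [Group Q] [TopologicalSpace Q]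

/-- A partial sorting data without empty values is a sorting data. -/
def toSortingData (Φ : PartialSortingData Jsub E) (h : ∀ N, (Φ.sorts N).Nonempty) :
    SortingData Jsub E where
  sorts := Φ.sorts
  nonempty := h
  whole := Φ.whole
  radical_iff N J := ⟨fun hJ J' hJ' => Φ.upward N J J' hJ' hJ, fun hJ => hJ (Set.Subset.refl _)⟩
  perm_iff N J J' hp := ⟨Φ.upward N J J' (SortTuple.supp_eq_of_perm hp).subset,
    Φ.upward N J' J (SortTuple.supp_eq_of_perm hp).superset⟩
  mono := Φ.mono
  inter := Φ.inter
  -- Conjugation fixes a normal subgroup, so `h` forces `N₁ = N₂`.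
  conj N₁ N₂ g h := by
    congr 1
    refine SetLike.ext fun x => ?_
    have h2 := Set.ext_iff.mp h x
    refine Iff.trans ?_ h2.symm
    refine ⟨fun hx => ⟨g * x * g⁻¹, N₁.isNormal'.conj_mem x hx g, by simp [mul_assoc]⟩, ?_⟩
    rintro ⟨y, hy, rfl⟩
    have h3 := N₁.isNormal'.conj_mem y hy g⁻¹
    rwa [inv_inv] at h3

instance : PartialOrder (PartialSortingData Jsub E) :=
  PartialOrder.lift PartialSortingData.sorts fun _ _ => PartialSortingData.ext

/-- The largest partial sorting data without values below the subgroup `K`. -/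
def above (Jsub : ℕ → SortTuple 𝒥 → SortTuple 𝒥) (K : Subgroup E) :
    PartialSortingData Jsub E where
  sorts N := {_J | K ≤ N}
  whole N h := by ext; simp [h]
  upward _ _ _ _ h := h
  mono _ _ _ _ hN _ h := fun _ hx => hN (h hx)
  inter _ _ _ _ h₁ h₂ := fun _ hx => ⟨h₁ hx, h₂ hx⟩

/-- The smallest partial sorting data above a set of partial sorting data. -/
def generate (S : Set (PartialSortingData Jsub E)) : PartialSortingData Jsub E where
  sorts N := {J | ∀ Θ ∈ upperBounds S, J ∈ Θ.sorts N}
  whole N h := by ext J; simp +contextual [PartialSortingData.whole _ N h]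
  upward N J J' hJ h Θ hΘ := Θ.upward N J J' hJ (h Θ hΘ)
  mono N₁ N₂ k J hN hk h Θ hΘ := Θ.mono N₁ N₂ k J hN hk (h Θ hΘ)
  inter N₁ N₂ J₁ J₂ h₁ h₂ Θ hΘ := Θ.inter N₁ N₂ J₁ J₂ (h₁ Θ hΘ) (h₂ Θ hΘ)

theorem isLUB_generate (S : Set (PartialSortingData Jsub E)) : IsLUB S (generate S) :=
  ⟨fun _ hΦ N _ hJ _ hΘ => hΘ hΦ N hJ, fun Θ hΘ _ _ hJ => hJ Θ hΘ⟩

instance : Max (PartialSortingData Jsub E) := ⟨fun Φ Ψ => generate {Φ, Ψ}⟩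

instance : SemilatticeSup (PartialSortingData Jsub E) where
  sup := (· ⊔ ·)
  le_sup_left Φ Ψ := (isLUB_generate {Φ, Ψ}).1 (by simp)
  le_sup_right Φ Ψ := (isLUB_generate {Φ, Ψ}).1 (by simp)
  sup_le Φ Ψ Θ h₁ h₂ := (isLUB_generate {Φ, Ψ}).2 (by simp [upperBounds, h₁, h₂])

/-- The union of a directed set of partial sorting data. -/
def directedUnion (S : Set (PartialSortingData Jsub E)) (hne : S.Nonempty)
    (hS : DirectedOn (· ≤ ·) S) : PartialSortingData Jsub E where
  sorts N := {J | ∃ Φ ∈ S, J ∈ Φ.sorts N}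
  whole N h := by
    obtain ⟨Φ, hΦ⟩ := hne
    ext J
    simp only [Set.mem_ofPred_eq, Set.mem_univ, iff_true]
    exact ⟨Φ, hΦ, by rw [Φ.whole N h]; trivial⟩
  upward N J J' hJ := by
    rintro ⟨Φ, hΦ, h⟩
    exact ⟨Φ, hΦ, Φ.upward N J J' hJ h⟩
  mono N₁ N₂ k J hN hk := by
    rintro ⟨Φ, hΦ, h⟩
    exact ⟨Φ, hΦ, Φ.mono N₁ N₂ k J hN hk h⟩
  -- This is the one axiom that needs directedness: it combines tuples from two members of `S`.
  inter N₁ N₂ J₁ J₂ := by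
    rintro ⟨Φ₁, hΦ₁, h₁⟩ ⟨Φ₂, hΦ₂, h₂⟩
    obtain ⟨Φ, hΦ, h₁', h₂'⟩ := hS Φ₁ hΦ₁ Φ₂ hΦ₂
    exact ⟨Φ, hΦ, Φ.inter N₁ N₂ J₁ J₂ (h₁' N₁ h₁) (h₂' N₂ h₂)⟩

theorem le_directedUnion (S : Set (PartialSortingData Jsub E)) (hne : S.Nonempty)
    (hS : DirectedOn (· ≤ ·) S) {Φ : PartialSortingData Jsub E} (hΦ : Φ ∈ S) :
    Φ ≤ directedUnion S hne hS := fun _ _ hJ => ⟨Φ, hΦ, hJ⟩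

/-- The push-forward of a partial sorting data along an epimorphism. -/
def push (Φ : PartialSortingData Jsub E) (f : E →ₜ* Q) (hf : Function.Surjective f) :
    PartialSortingData Jsub Q where
  sorts M := Φ.sorts (M.preimage f)
  whole M h := Φ.whole _ ((OpenNormalSubgroup.preimage_eq_top_iff f hf M).mpr h)
  upward _ := Φ.upward _
  mono M₁ M₂ k J hM hk h := Φ.mono _ _ k J (OpenNormalSubgroup.preimage_mono f hM)
    (by rwa [OpenNormalSubgroup.index_preimage f hf]) h
  inter M₁ M₂ J₁ J₂ h₁ h₂ := Φ.inter _ _ J₁ J₂ h₁ h₂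

/-- The pull-back of a partial sorting data along an open epimorphism; it only has values at
preimages of subgroups. -/
def pull (Φ : PartialSortingData Jsub Q) (e : E →ₜ* Q) (he : Function.Surjective e)
    (ho : IsOpenMap e) : PartialSortingData Jsub E where
  sorts N := {J | ∃ M : OpenNormalSubgroup Q, M.preimage e = N ∧ J ∈ Φ.sorts M}
  whole N h := by
    have h1 : (N.image e he ho).preimage e = N :=
      N.preimage_image e he ho fun x _ => (by
        have : x ∈ (N : Subgroup E) := by rw [h]; trivial
        exact this)
    ext J
    simp only [Set.mem_ofPred_eq, Set.mem_univ, iff_true]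
    refine ⟨_, h1, ?_⟩
    rw [Φ.whole]
    · trivial
    · rw [← OpenNormalSubgroup.preimage_eq_top_iff e he, h1, h]
  upward N J J' hJ := by
    rintro ⟨M, hM, h⟩
    exact ⟨M, hM, Φ.upward M J J' hJ h⟩
  mono N₁ N₂ k J hN hk := by
    rintro ⟨M, rfl, h⟩
    -- `N₂` contains a preimage, hence the kernel of `e`, so it is itself a preimage.
    have h1 : (N₂.image e he ho).preimage e = N₂ :=
      N₂.preimage_image e he ho fun x hx => hN (by
        rw [OpenNormalSubgroup.mem_preimage, hx]; exact one_mem M)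
    refine ⟨_, h1, Φ.mono M _ k J ?_ ?_ h⟩
    · intro q hq
      obtain ⟨x, rfl⟩ := he q
      exact ⟨x, hN hq, rfl⟩
    · rwa [OpenNormalSubgroup.index_preimage e he] at hk
  inter N₁ N₂ J₁ J₂ := by
    rintro ⟨M₁, rfl, h₁⟩ ⟨M₂, rfl, h₂⟩
    exact ⟨M₁ ⊓ M₂, rfl, Φ.inter M₁ M₂ J₁ J₂ h₁ h₂⟩

end Basic

/-! ### The sorted quotient attached to a partial sorting data. -/

section Quotient

variable {E : ProfiniteGrp.{u}} (Φ : PartialSortingData Jsub E)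

/-- The intersection of the open normal subgroups at which the value is non-empty. -/
def kernel : Subgroup E where
  carrier := {x | ∀ N, (Φ.sorts N).Nonempty → x ∈ N}
  one_mem' N _ := one_mem N
  mul_mem' hx hy N h := mul_mem (hx N h) (hy N h)
  inv_mem' hx N h := inv_mem (hx N h)

theorem mem_kernel {x : E} : x ∈ Φ.kernel ↔ ∀ N, (Φ.sorts N).Nonempty → x ∈ N := Iff.rfl

instance : Φ.kernel.Normal := ⟨fun x hx g N h => N.isNormal'.conj_mem x (hx N h) g⟩

theorem isClosed_kernel : IsClosed (Φ.kernel : Set E) := by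
  have : (Φ.kernel : Set E) = ⋂ N : {N // (Φ.sorts N).Nonempty}, (N.1 : Set E) := by
    ext x
    simp [mem_kernel]
  rw [this]
  exact isClosed_iInter fun N => N.1.toOpenSubgroup.isClosed

theorem kernel_anti {Φ Ψ : PartialSortingData Jsub E} (h : Φ ≤ Ψ) : Ψ.kernel ≤ Φ.kernel :=
  fun _ hx N hN => hx N (hN.mono (h N))

instance : TotallyDisconnectedSpace (E ⧸ Φ.kernel) :=
  QuotientGroup.totallyDisconnectedSpace _ Φ.isClosed_kernel

/-- By `inter`, the subgroups with non-empty value are directed downwards. By compactness one of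
them lies in `N`, and `mono` transports a tuple from it to `N`. This is why the quotient by the
kernel carries a genuine sorting data. -/
theorem nonempty_of_kernel_le [Nonempty (SortTuple 𝒥)] (N : OpenNormalSubgroup E)
    (h : ∀ x ∈ Φ.kernel, x ∈ N) : (Φ.sorts N).Nonempty := by
  let T : OpenNormalSubgroup E := ⟨⊤, inferInstanceAs (⊤ : Subgroup E).Normal⟩
  have : Nonempty {N // (Φ.sorts N).Nonempty} :=
    ⟨T, by rw [Φ.whole T rfl]; exact Set.univ_nonempty⟩
  have hdir : Directed (· ≥ ·)
      fun N : {N // (Φ.sorts N).Nonempty} => (N.1 : Subgroup E) := by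
    rintro ⟨N₁, J₁, h₁⟩ ⟨N₂, J₂, h₂⟩
    exact ⟨⟨N₁ ⊓ N₂, _, Φ.inter _ _ _ _ h₁ h₂⟩, fun x hx => hx.1, fun x hx => hx.2⟩
  obtain ⟨⟨M, J, hJ⟩, hM⟩ := Subgroup.exists_le_of_iInf_le _ hdir
    (fun N => N.1.toOpenSubgroup.isClosed) N.isOpen' fun x hx => h x fun M hM => hx ⟨M, hM⟩
  exact ⟨_, Φ.mono M N _ J hM le_rfl hJ⟩

/-- The sorted profinite group defined by a partial sorting data. -/
def toSorted [Nonempty (SortTuple 𝒥)] : SortedProfiniteGrp.{u} Jsub where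
  grp := ProfiniteGrp.of (E ⧸ Φ.kernel)
  data := (Φ.push ⟨QuotientGroup.mk' Φ.kernel, continuous_quotient_mk'⟩
    (QuotientGroup.mk'_surjective _)).toSortingData fun M =>
    Φ.nonempty_of_kernel_le _ fun x hx => by
      have : (QuotientGroup.mk' Φ.kernel x) = 1 := (QuotientGroup.eq_one_iff x).mpr hx
      change QuotientGroup.mk' Φ.kernel x ∈ M
      rw [this]
      exact one_mem M

end Quotient

section Morphisms

open SortedProfiniteGrp

variable {E : ProfiniteGrp.{u}} [Nonempty (SortTuple 𝒥)] {Φ Ψ : PartialSortingData Jsub E}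

variable (Φ) in
/-- The quotient map onto the group underlying a partial sorting data. -/
def proj : E →ₜ* Φ.toSorted.grp :=
  ⟨QuotientGroup.mk' Φ.kernel, continuous_quotient_mk'⟩

variable (Φ) in
theorem proj_surjective : Function.Surjective Φ.proj := QuotientGroup.mk'_surjective Φ.kernel

variable (Φ) in
theorem proj_isOpenMap : IsOpenMap Φ.proj :=
  Φ.proj.isOpenMap_of_surjective Φ.proj_surjective

theorem proj_eq_one_iff {x : E} : Φ.proj x = 1 ↔ x ∈ Φ.kernel := QuotientGroup.eq_one_iff x

theorem mem_toSorted {N : OpenNormalSubgroup Φ.toSorted.grp} {J : SortTuple 𝒥} :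
    J ∈ Φ.toSorted.data.sorts N ↔ J ∈ Φ.sorts (N.preimage Φ.proj) := Iff.rfl

theorem exists_preimage_proj_eq {N : OpenNormalSubgroup E}
    (h : ∀ x ∈ Φ.kernel, x ∈ N) :
    ∃ M : OpenNormalSubgroup Φ.toSorted.grp, M.preimage Φ.proj = N :=
  ⟨_, N.preimage_image _ Φ.proj_surjective Φ.proj_isOpenMap fun x hx =>
    h x (proj_eq_one_iff.mp hx)⟩

/-- A group epimorphism onto the quotient defined by a partial sorting data `Φ` is sorted if `Φ` is
below the pull-back of the push-forward. -/
theorem sorted_of_le {Z : SortedProfiniteGrp.{u} Jsub} (r : Z.grp →ₜ* Φ.toSorted.grp)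
    (hr : Function.Surjective r)
    (h : Φ ≤ (Z.data.toPartial.push r hr).pull Φ.proj Φ.proj_surjective Φ.proj_isOpenMap) :
    ∀ N, Φ.toSorted.data.sorts N ⊆ Z.data.sorts (N.preimage r) := by
  intro N J hJ
  obtain ⟨M, hM, hJ'⟩ := h _ hJ
  obtain rfl := OpenNormalSubgroup.preimage_injective _ Φ.proj_surjective hM
  exact hJ'

/-- The epimorphism between the quotients defined by comparable partial sorting data. -/
theorem exists_res (h : Φ ≤ Ψ) :
    ∃ f : Ψ.toSorted ⟶ Φ.toSorted, ∀ x, f.map (Ψ.proj x) = Φ.proj x := by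
  obtain ⟨f, hf⟩ := Ψ.proj.exists_factor Ψ.proj_surjective Φ.proj fun x hx =>
    proj_eq_one_iff.mpr (kernel_anti h (proj_eq_one_iff.mp hx))
  refine ⟨⟨f, fun q => ?_, fun N J hJ => ?_⟩, hf⟩
  · obtain ⟨x, rfl⟩ := Φ.proj_surjective q
    exact ⟨_, hf x⟩
  · have h1 : (N.preimage f).preimage Ψ.proj = N.preimage Φ.proj :=
      SetLike.ext fun x => by simp only [OpenNormalSubgroup.mem_preimage, hf]
    rw [mem_toSorted, h1]
    exact h _ hJ

/-- The epimorphism between the quotients defined by comparable partial sorting data. -/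
noncomputable def res (h : Φ ≤ Ψ) : Ψ.toSorted ⟶ Φ.toSorted := (exists_res h).choose

@[simp]
theorem res_proj (h : Φ ≤ Ψ) (x : E) : (res h).map (Ψ.proj x) = Φ.proj x :=
  (exists_res h).choose_spec x

end Morphisms

end PartialSortingData

namespace SortedProfiniteGrp

variable {𝒥 : Type v} {Jsub : ℕ → SortTuple 𝒥 → SortTuple 𝒥}

@[simp]
theorem comp_map_apply {X Y Z : SortedProfiniteGrp.{u} Jsub} (f : X ⟶ Y) (g : Y ⟶ Z) (x : X.grp) :
    (f ≫ g).map x = g.map (f.map x) := rfl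

@[simp]
theorem id_map_apply (X : SortedProfiniteGrp.{u} Jsub) (x : X.grp) :
    Hom.map (𝟙 X) x = x := rfl

theorem hom_ext {X Y : SortedProfiniteGrp.{u} Jsub} {f g : X ⟶ Y} (h : ∀ x, f.map x = g.map x) :
    f = g :=
  Hom.ext (ContinuousMonoidHom.ext h)

/-- Morphisms out of the quotient defined by a partial sorting data are determined on the group. -/
theorem hom_ext_proj [Nonempty (SortTuple 𝒥)] {E : ProfiniteGrp.{u}}
    {Φ : PartialSortingData Jsub E}
    {Y : SortedProfiniteGrp.{u} Jsub} {f g : Φ.toSorted ⟶ Y}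
    (h : ∀ x, f.map (Φ.proj x) = g.map (Φ.proj x)) : f = g :=
  hom_ext fun q => by
    obtain ⟨x, rfl⟩ := Φ.proj_surjective q
    exact h x

theorem nonempty_sortTuple (X : SortedProfiniteGrp.{u} Jsub) : Nonempty (SortTuple 𝒥) :=
  ⟨(X.data.nonempty ⟨⊤, inferInstanceAs (⊤ : Subgroup X.grp).Normal⟩).some⟩

end SortedProfiniteGrp

/-! ### Consequences of SEP for the sorting data. -/

namespace SortedProfiniteGrp

variable {𝒥 : Type v} {Jsub : ℕ → SortTuple 𝒥 → SortTuple 𝒥}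

/-- The push-forward of the sorting data of `Y` along an epimorphism. -/
abbrev pushforward (Y : SortedProfiniteGrp.{u} Jsub) {A : ProfiniteGrp.{u}} (f : Y.grp →ₜ* A)
    (hf : Function.Surjective f) : SortedProfiniteGrp.{u} Jsub where
  grp := A
  data := (Y.data.toPartial.push f hf).toSortingData fun _ => Y.data.nonempty _

/-- An epimorphism of groups as a morphism to the push-forward. -/
def toPushforward (Y : SortedProfiniteGrp.{u} Jsub) {A : ProfiniteGrp.{u}} (f : Y.grp →ₜ* A)
    (hf : Function.Surjective f) : Y ⟶ Y.pushforward f hf :=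
  Hom.mk f hf fun _ _ h => h

/-- The intersection of two sorting data on a group. -/
abbrev inf (A : ProfiniteGrp.{u}) (F F' : SortingData Jsub A) : SortedProfiniteGrp.{u} Jsub where
  grp := A
  data := PartialSortingData.toSortingData
    { sorts N := F.sorts N ∩ F'.sorts N
      whole N h := by rw [F.whole N h, F'.whole N h, Set.inter_univ]
      upward N J J' hJ h :=
        ⟨F.toPartial.upward N J J' hJ h.1, F'.toPartial.upward N J J' hJ h.2⟩
      mono N₁ N₂ k J hN hk h := ⟨F.mono N₁ N₂ k J hN hk h.1, F'.mono N₁ N₂ k J hN hk h.2⟩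
      inter N₁ N₂ J₁ J₂ h₁ h₂ :=
        ⟨F.inter N₁ N₂ J₁ J₂ h₁.1 h₂.1, F'.inter N₁ N₂ J₁ J₂ h₁.2 h₂.2⟩ }
    fun N => by
      obtain ⟨J, hJ⟩ := F.nonempty N
      obtain ⟨J', hJ'⟩ := F'.nonempty N
      refine ⟨J.concat J', F.toPartial.upward N J _ ?_ hJ, F'.toPartial.upward N J' _ ?_ hJ'⟩ <;>
        rw [SortTuple.supp_concat]
      · exact Set.subset_union_left
      · exact Set.subset_union_right

/-- With the sorted embedding property, the value of the sorting data at an open normal subgroup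
only depends on the quotient group. -/
theorem HasSEP.sorts_preimage_subset {Y : SortedProfiniteGrp.{u} Jsub} (hY : Y.HasSEP)
    {A : ProfiniteGrp.{u}} [hA : Finite A] (f g : Y.grp →ₜ* A) (hf : Function.Surjective f)
    (hg : Function.Surjective g) (N : OpenNormalSubgroup A) :
    Y.data.sorts (N.preimage f) ⊆ Y.data.sorts (N.preimage g) := by
  -- With the intersected data on `A`, both `f` and `g` become morphisms to `B`. Lifting `g` through
  -- the identity of the group `A` then makes `g` sorted for the data pushed forward along `f`.
  let B := inf A (Y.pushforward f hf).data (Y.pushforward g hg).data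
  let π : Y.pushforward f hf ⟶ B :=
    Hom.mk (ContinuousMonoidHom.id A) Function.surjective_id fun _ _ h => h.1
  let φ : Y ⟶ B := Hom.mk g hg fun _ _ h => h.2
  let φ' : Y ⟶ B := Hom.mk f hf fun _ _ h => h.1
  obtain ⟨ψ, hψ⟩ := hY (Y.pushforward f hf) B hA hA ⟨Y.toPushforward f hf⟩ ⟨φ⟩ π φ
  have : ψ.map = g := congrArg Hom.map hψ
  intro J hJ
  have h := ψ.sorted N hJ
  rwa [this] at h

theorem eq_one_of_forall_mem {G : ProfiniteGrp.{u}} {x : G}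
    (h : ∀ N : OpenNormalSubgroup G, x ∈ N) : x = 1 := by
  by_contra hx
  obtain ⟨N, hN⟩ := ProfiniteGrp.exist_openNormalSubgroup_sub_open_nhds_of_one
    (isOpen_compl_singleton (x := x)) (by simpa using Ne.symm hx)
  exact hN (h N) rfl

end SortedProfiniteGrp

/-! ### Sorted quotients of a fixed group, and suprema as fibre products. -/

namespace PartialSortingData

open SortedProfiniteGrp

variable {𝒥 : Type v} {Jsub : ℕ → SortTuple 𝒥 → SortTuple 𝒥} {E : ProfiniteGrp.{u}}

/-- The partial sorting data on `E` that a sorted profinite group defines along an epimorphism. -/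
def ofSurjective (W : SortedProfiniteGrp.{u} Jsub) (e : E →ₜ* W.grp)
    (he : Function.Surjective e) : PartialSortingData Jsub E :=
  W.data.toPartial.pull e he (e.isOpenMap_of_surjective he)

theorem ofSurjective_le_above (W : SortedProfiniteGrp.{u} Jsub) (e : E →ₜ* W.grp)
    (he : Function.Surjective e) {K : Subgroup E} (hK : ∀ x ∈ K, e x = 1) :
    ofSurjective W e he ≤ above Jsub K := by
  rintro N J ⟨M, rfl, -⟩ x hx
  change e x ∈ M
  rw [hK x hx]
  exact one_mem M

theorem le_above_kernel (Φ : PartialSortingData Jsub E) : Φ ≤ above Jsub Φ.kernel :=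
  fun N _ hJ _ hx => hx N ⟨_, hJ⟩

theorem kernel_of_le_above {Φ : PartialSortingData Jsub E} {K : Subgroup E}
    (h : Φ ≤ above Jsub K) : K ≤ Φ.kernel := by
  rintro x hx N ⟨J, hJ⟩
  exact h N hJ hx

theorem eq_one_of_mem_kernel {Φ : PartialSortingData Jsub E} {W : SortedProfiniteGrp.{u} Jsub}
    {e : E →ₜ* W.grp} {he : Function.Surjective e} (h : ofSurjective W e he ≤ Φ) {x : E}
    (hx : x ∈ Φ.kernel) : e x = 1 :=
  eq_one_of_forall_mem fun N => by
    obtain ⟨J, hJ⟩ := W.data.nonempty N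
    exact hx (N.preimage e) ⟨J, h _ ⟨N, rfl, hJ⟩⟩

variable [Nonempty (SortTuple 𝒥)] {Φ : PartialSortingData Jsub E}

/-- A subgroup with non-empty value contains the kernel and so comes from the quotient; no value is
lost in passing there and back. -/
theorem ofSurjective_toSorted : ofSurjective Φ.toSorted Φ.proj Φ.proj_surjective = Φ := by
  refine le_antisymm ?_ fun N J hJ => ?_
  · rintro N J ⟨M, rfl, h⟩
    exact h
  · obtain ⟨M, rfl⟩ := exists_preimage_proj_eq (Φ := Φ) (N := N) fun x hx => hx N ⟨J, hJ⟩
    exact ⟨M, rfl, hJ⟩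

theorem exists_hom_of_ofSurjective_le {W : SortedProfiniteGrp.{u} Jsub} {e : E →ₜ* W.grp}
    {he : Function.Surjective e} (h : ofSurjective W e he ≤ Φ) :
    ∃ f : Φ.toSorted ⟶ W, ∀ x, f.map (Φ.proj x) = e x := by
  obtain ⟨f, hf⟩ := Φ.proj.exists_factor Φ.proj_surjective e fun x hx =>
    eq_one_of_mem_kernel h (proj_eq_one_iff.mp hx)
  refine ⟨Hom.mk f (fun q => ?_) fun N J hJ => ?_, hf⟩
  · obtain ⟨x, rfl⟩ := he q
    exact ⟨_, hf x⟩
  · have h1 : (N.preimage f).preimage Φ.proj = N.preimage e :=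
      SetLike.ext fun x => by simp only [OpenNormalSubgroup.mem_preimage, hf]
    rw [mem_toSorted, h1]
    exact h _ ⟨N, rfl, hJ⟩

/-- If the composition of `r : Z → E/K` with a group epimorphism to `W` is sorted, then `W`
contributes nothing new to the partial sorting data that `Z` defines. -/
theorem ofSurjective_le_transfer {Z W : SortedProfiniteGrp.{u} Jsub}
    (r : Z.grp →ₜ* Φ.toSorted.grp) (hr : Function.Surjective r) (e : E →ₜ* W.grp)
    (he : Function.Surjective e) (g : Φ.toSorted.grp →ₜ* W.grp) (hg : ∀ x, g (Φ.proj x) = e x)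
    (h : ∀ N, W.data.sorts N ⊆ Z.data.sorts ((N.preimage g).preimage r)) :
    ofSurjective W e he ≤
      (Z.data.toPartial.push r hr).pull Φ.proj Φ.proj_surjective Φ.proj_isOpenMap := by
  rintro N J ⟨M, rfl, hJ⟩
  refine ⟨M.preimage g, ?_, h M hJ⟩
  exact SetLike.ext fun x => by simp only [OpenNormalSubgroup.mem_preimage, hg]

section Sup

variable {A : SortedProfiniteGrp.{u} Jsub} {ψ : E →ₜ* A.grp} {hψ : Function.Surjective ψ}

variable (Φ ψ hψ) in
/-- The projection to `A` from the group defined by the supremum. -/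
theorem exists_supSnd : ∃ f : (Φ ⊔ ofSurjective A ψ hψ).toSorted ⟶ A,
    ∀ x, f.map ((Φ ⊔ ofSurjective A ψ hψ).proj x) = ψ x :=
  exists_hom_of_ofSurjective_le le_sup_right

/-- Both terms of the supremum lie below `above Jsub (Φ.kernel ⊓ ker ψ)`, hence so does the
supremum, and its kernel contains that intersection. -/
theorem sup_prod_injective (f : (Φ ⊔ ofSurjective A ψ hψ).toSorted ⟶ A)
    (hf : ∀ x, f.map ((Φ ⊔ ofSurjective A ψ hψ).proj x) = ψ x) :
    Function.Injective ((res (Φ := Φ) (Ψ := Φ ⊔ ofSurjective A ψ hψ) le_sup_left).map.prod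
      f.map) := by
  refine (injective_iff_map_eq_one _).mpr fun q hq => ?_
  obtain ⟨x, rfl⟩ := proj_surjective _ q
  obtain ⟨h1, h2⟩ := Prod.ext_iff.mp hq
  have h1' : (res (Φ := Φ) (Ψ := Φ ⊔ ofSurjective A ψ hψ) le_sup_left).map
    ((Φ ⊔ ofSurjective A ψ hψ).proj x) = 1 := h1
  have h2' : f.map ((Φ ⊔ ofSurjective A ψ hψ).proj x) = 1 := h2
  rw [res_proj, proj_eq_one_iff] at h1'
  rw [hf] at h2'
  refine proj_eq_one_iff.mpr (kernel_of_le_above (K := Φ.kernel ⊓ ψ.toMonoidHom.ker) ?_ ⟨h1', h2'⟩)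
  refine sup_le ?_ (ofSurjective_le_above _ _ _ fun x hx => hx.2)
  exact Φ.le_above_kernel.trans fun N _ h x hx => h hx.1

/-- Through `r`, the data of `Z` induces a partial sorting data on `E`. The two hypotheses say that
it is an upper bound of both terms, so it dominates their supremum. -/
theorem sorted_sup (f : (Φ ⊔ ofSurjective A ψ hψ).toSorted ⟶ A)
    (hf : ∀ x, f.map ((Φ ⊔ ofSurjective A ψ hψ).proj x) = ψ x)
    {Z : SortedProfiniteGrp.{u} Jsub} (r : Z.grp →ₜ* (Φ ⊔ ofSurjective A ψ hψ).toSorted.grp)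
    (hr : Function.Surjective r)
    (h₁ : ∀ N, Φ.toSorted.data.sorts N ⊆
      Z.data.sorts ((N.preimage (res le_sup_left).map).preimage r))
    (h₂ : ∀ N, A.data.sorts N ⊆ Z.data.sorts ((N.preimage f.map).preimage r)) (N) :
    (Φ ⊔ ofSurjective A ψ hψ).toSorted.data.sorts N ⊆ Z.data.sorts (N.preimage r) := by
  refine sorted_of_le r hr (sup_le ?_ ?_) N
  · conv_lhs => rw [← ofSurjective_toSorted (Φ := Φ)]
    exact ofSurjective_le_transfer r hr _ _ (res le_sup_left).map (res_proj _) h₁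
  · exact ofSurjective_le_transfer r hr _ _ f.map hf h₂

/-- Lifting to the group defined by a supremum. -/
theorem exists_lift_sup {Z : SortedProfiniteGrp.{u} Jsub} (r : Z ⟶ Φ.toSorted) (ψZ : Z ⟶ A)
    (h₁ : ∀ z, ∃ x, Φ.proj x = r.map z ∧ ψ x = ψZ.map z)
    (h₂ : ∀ x, ∃ z, r.map z = Φ.proj x ∧ ψZ.map z = ψ x) :
    ∃ r' : Z ⟶ (Φ ⊔ ofSurjective A ψ hψ).toSorted, r' ≫ res le_sup_left = r := by
  obtain ⟨f, hf⟩ := exists_supSnd Φ ψ hψ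
  have hinj := sup_prod_injective f hf
  obtain ⟨l, hl⟩ := ContinuousMonoidHom.exists_lift_of_injective _ hinj (r.map.prod ψZ.map)
    fun z => by
      obtain ⟨x, hx, hx'⟩ := h₁ z
      refine ⟨(Φ ⊔ ofSurjective A ψ hψ).proj x, Prod.ext ?_ ?_⟩
      · exact (res_proj _ _).trans hx
      · exact (hf x).trans hx'
  have hl₁ : ∀ z, (res le_sup_left).map (l z) = r.map z := fun z => congrArg Prod.fst (hl z)
  have hl₂ : ∀ z, f.map (l z) = ψZ.map z := fun z => congrArg Prod.snd (hl z)
  -- `h₂` says that every pair of values attained on `E` is attained on `Z`.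
  have hsurj : Function.Surjective l := fun q => by
    obtain ⟨x, rfl⟩ := proj_surjective _ q
    obtain ⟨z, hz, hz'⟩ := h₂ x
    refine ⟨z, hinj (Prod.ext ?_ ?_)⟩
    · exact (hl₁ z).trans (hz.trans (res_proj _ _).symm)
    · exact (hl₂ z).trans (hz'.trans (hf x).symm)
  refine ⟨Hom.mk l hsurj (sorted_sup f hf l hsurj (fun N J hJ => ?_) fun N J hJ => ?_),
    hom_ext hl₁⟩
  · have : (N.preimage (res le_sup_left).map).preimage l = N.preimage r.map :=
      SetLike.ext fun x => by simp only [OpenNormalSubgroup.mem_preimage, hl₁]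
    rw [this]
    exact r.sorted N hJ
  · have : (N.preimage f.map).preimage l = N.preimage ψZ.map :=
      SetLike.ext fun x => by simp only [OpenNormalSubgroup.mem_preimage, hl₂]
    rw [this]
    exact ψZ.sorted N hJ

/-- `hex` makes `E` cover the fibre product of groups; minimality of the data is `sorted_sup` for
the identity map into the same group with data `F`. -/
theorem isFibreProduct_sup {A₀ : SortedProfiniteGrp.{u} Jsub} (π₁ : Φ.toSorted ⟶ A₀)
    (π₂ : A ⟶ A₀) (h : ∀ x, π₁.map (Φ.proj x) = π₂.map (ψ x))
    (hex : ∀ q a, π₁.map q = π₂.map a → ∃ x, Φ.proj x = q ∧ ψ x = a)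
    (f : (Φ ⊔ ofSurjective A ψ hψ).toSorted ⟶ A)
    (hf : ∀ x, f.map ((Φ ⊔ ofSurjective A ψ hψ).proj x) = ψ x) :
    IsFibreProduct π₁ π₂ (res (Φ := Φ) (Ψ := Φ ⊔ ofSurjective A ψ hψ) le_sup_left) f where
  comm := hom_ext_proj fun x => by simp [hf, h]
  existsUnique q a hqa := by
    obtain ⟨x, rfl, rfl⟩ := hex q a hqa
    refine ⟨(Φ ⊔ ofSurjective A ψ hψ).proj x, ⟨res_proj _ _, hf x⟩, ?_⟩
    rintro b ⟨hb₁, hb₂⟩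
    exact sup_prod_injective f hf
      (Prod.ext (hb₁.trans (res_proj _ _).symm) (hb₂.trans (hf x).symm))
  minimal F h₁ h₂ N :=
    sorted_sup (Z := ⟨(Φ ⊔ ofSurjective A ψ hψ).toSorted.grp, F⟩) f hf
      (ContinuousMonoidHom.id _) Function.surjective_id h₁ h₂ N

end Sup

end PartialSortingData

/-! ### Directed unions as inverse limits. -/

namespace PartialSortingData

open SortedProfiniteGrp

variable {𝒥 : Type v} {Jsub : ℕ → SortTuple 𝒥 → SortTuple 𝒥} {E : ProfiniteGrp.{u}}

theorem kernel_directedUnion (S : Set (PartialSortingData Jsub E)) (hne : S.Nonempty)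
    (hS : DirectedOn (· ≤ ·) S) {x : E} (hx : ∀ Φ ∈ S, x ∈ Φ.kernel) :
    x ∈ (directedUnion S hne hS).kernel := by
  rintro N ⟨J, Φ, hΦ, hJ⟩
  exact hx Φ hΦ N ⟨J, hJ⟩

variable [Nonempty (SortTuple 𝒥)]

@[simp]
theorem res_refl (Φ : PartialSortingData Jsub E) : res (le_refl Φ) = 𝟙 Φ.toSorted :=
  hom_ext_proj fun x => by rw [res_proj, id_map_apply]

@[simp]
theorem res_comp {Φ Ψ Θ : PartialSortingData Jsub E} (h : Φ ≤ Ψ) (h' : Ψ ≤ Θ) :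
    res h' ≫ res h = res (h.trans h') :=
  hom_ext_proj fun x => by rw [comp_map_apply, res_proj, res_proj, res_proj]

/-- A compatible family of maps from a compact space attains a compatible family of values
simultaneously as soon as it attains each of them. -/
theorem exists_forall_eq {X : Type*} [TopologicalSpace X] [CompactSpace X]
    (S : Set (PartialSortingData Jsub E)) (hne : S.Nonempty) (hS : DirectedOn (· ≤ ·) S)
    (g : ∀ Φ : S, X → Φ.1.toSorted.grp) (hg : ∀ Φ, Continuous (g Φ))
    (hsurj : ∀ Φ, Function.Surjective (g Φ))
    (hcomp : ∀ (Φ Ψ : S) (h : Φ.1 ≤ Ψ.1) x, (res h).map (g Ψ x) = g Φ x)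
    (y : ∀ Φ : S, Φ.1.toSorted.grp)
    (hy : ∀ (Φ Ψ : S) (h : Φ.1 ≤ Ψ.1), (res h).map (y Ψ) = y Φ) :
    ∃ x, ∀ Φ, g Φ x = y Φ := by
  have : Nonempty S := hne.to_subtype
  have hcl : ∀ Φ, IsClosed (g Φ ⁻¹' {y Φ}) := fun Φ => isClosed_singleton.preimage (hg Φ)
  have := IsCompact.nonempty_iInter_of_directed_nonempty_isCompact_isClosed
    (fun Φ : S => g Φ ⁻¹' {y Φ}) ?_ (fun Φ => ?_) (fun Φ => (hcl Φ).isCompact) hcl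
  · obtain ⟨x, hx⟩ := this
    exact ⟨x, fun Φ => Set.mem_iInter.mp hx Φ⟩
  · rintro ⟨Φ, hΦ⟩ ⟨Ψ, hΨ⟩
    obtain ⟨Θ, hΘ, h₁, h₂⟩ := hS Φ hΦ Ψ hΨ
    refine ⟨⟨Θ, hΘ⟩, fun x hx => ?_, fun x hx => ?_⟩ <;>
      simp only [Set.mem_preimage, Set.mem_singleton_iff] at hx ⊢
    · rw [← hcomp _ ⟨Θ, hΘ⟩ h₁, hx, hy _ ⟨Θ, hΘ⟩ h₁]
    · rw [← hcomp _ ⟨Θ, hΘ⟩ h₂, hx, hy _ ⟨Θ, hΘ⟩ h₂]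
  · obtain ⟨x, hx⟩ := hsurj Φ (y Φ)
    exact ⟨x, hx⟩

/-- The group defined by a directed union has the mapping property of an inverse limit. -/
theorem exists_lift_directedUnion (S : Set (PartialSortingData Jsub E)) (hne : S.Nonempty)
    (hS : DirectedOn (· ≤ ·) S) {Z : SortedProfiniteGrp.{u} Jsub}
    (r : ∀ Φ : S, Z ⟶ Φ.1.toSorted)
    (hr : ∀ (Φ Ψ : S) (h : Φ.1 ≤ Ψ.1), r Ψ ≫ res h = r Φ) :
    ∃ l : Z ⟶ (directedUnion S hne hS).toSorted,
      ∀ Φ : S, l ≫ res (le_directedUnion S hne hS Φ.2) = r Φ := by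
  have hr' : ∀ (Φ Ψ : S) (h : Φ.1 ≤ Ψ.1) z, (res h).map ((r Ψ).map z) = (r Φ).map z :=
    fun Φ Ψ h z => by rw [← comp_map_apply, hr]
  let U := directedUnion S hne hS
  let p : ∀ Φ : S, U.toSorted ⟶ Φ.1.toSorted := fun Φ => res (le_directedUnion S hne hS Φ.2)
  let f : U.toSorted.grp →ₜ* (∀ Φ : S, Φ.1.toSorted.grp) :=
    ⟨MonoidHom.pi fun Φ => (p Φ).map.toMonoidHom,
      continuous_pi fun Φ => (p Φ).map.continuous_toFun⟩
  let g : Z.grp →ₜ* (∀ Φ : S, Φ.1.toSorted.grp) :=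
    ⟨MonoidHom.pi fun Φ => (r Φ).map.toMonoidHom,
      continuous_pi fun Φ => (r Φ).map.continuous_toFun⟩
  have hf : ∀ q Φ, f q Φ = (p Φ).map q := fun _ _ => rfl
  have hg : ∀ z Φ, g z Φ = (r Φ).map z := fun _ _ => rfl
  have hp : ∀ x Φ, (p Φ).map (U.proj x) = Φ.1.proj x := fun x Φ => res_proj _ _
  have hinj : Function.Injective f := by
    refine (injective_iff_map_eq_one _).mpr fun q hq => ?_
    obtain ⟨x, rfl⟩ := U.proj_surjective q
    refine proj_eq_one_iff.mpr (kernel_directedUnion S hne hS fun Φ hΦ => ?_)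
    rw [← proj_eq_one_iff, ← hp x ⟨Φ, hΦ⟩, ← hf, hq]
    rfl
  -- By compactness of `E`, the compatible values `(r Φ).map z` come from a single element of `E`.
  -- The same argument in `Z` gives surjectivity of `l` below.
  obtain ⟨l, hl⟩ := ContinuousMonoidHom.exists_lift_of_injective f hinj g fun z => by
    obtain ⟨x, hx⟩ := exists_forall_eq S hne hS (fun Φ => Φ.1.proj)
      (fun Φ => Φ.1.proj.continuous_toFun) (fun Φ => Φ.1.proj_surjective)
      (fun Φ Ψ h x => res_proj h x) (fun Φ => (r Φ).map z) fun Φ Ψ h => hr' Φ Ψ h z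
    exact ⟨U.proj x, funext fun Φ => by rw [hf, hg, hp, hx]⟩
  have hl' : ∀ z Φ, (p Φ).map (l z) = (r Φ).map z := fun z Φ => congrFun (hl z) Φ
  have hsurj : Function.Surjective l := fun q => by
    obtain ⟨x, rfl⟩ := U.proj_surjective q
    obtain ⟨z, hz⟩ := exists_forall_eq S hne hS (fun Φ => (r Φ).map)
      (fun Φ => (r Φ).map.continuous_toFun) (fun Φ => (r Φ).surjective) hr'
      (fun Φ => Φ.1.proj x) fun Φ Ψ h => res_proj h x
    exact ⟨z, hinj (funext fun Φ => by rw [hf, hl', hz, hf, hp])⟩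
  refine ⟨Hom.mk l hsurj (sorted_of_le l hsurj ?_), fun Φ => hom_ext fun z => hl' z Φ⟩
  -- A tuple of the union already belongs to one `Φ`, where `r Φ` is sorted.
  rintro N J ⟨Φ, hΦ, hJ⟩
  have h1 := ofSurjective_le_transfer (W := Φ.toSorted) l hsurj Φ.proj Φ.proj_surjective
    (p ⟨Φ, hΦ⟩).map (fun x => hp x ⟨Φ, hΦ⟩) fun N J hJ => by
      have : (N.preimage (p ⟨Φ, hΦ⟩).map).preimage l = N.preimage (r ⟨Φ, hΦ⟩).map :=
        SetLike.ext fun z => by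
          simp only [OpenNormalSubgroup.mem_preimage, hl' z ⟨Φ, hΦ⟩]
      rw [this]
      exact (r ⟨Φ, hΦ⟩).sorted N hJ
  rw [ofSurjective_toSorted] at h1
  exact h1 N hJ

/-- The inverse system of the groups defined by a set of partial sorting data. -/
noncomputable def diagram (S : Set (PartialSortingData Jsub E)) :
    (S)ᵒᵖ ⥤ SortedProfiniteGrp.{u} Jsub where
  obj Φ := Φ.unop.1.toSorted
  map f := res (leOfHom f.unop)
  map_id _ := res_refl _
  map_comp _ _ := (res_comp _ _).symm

open Limits

/-- The union defines the limit of `diagram S`: lifts come from `exists_lift_directedUnion`, and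
they are unique because an element killed by every projection lies in every kernel, hence in the
kernel of the union. -/
theorem prop_directedUnion (𝒞 : ObjectProperty (SortedProfiniteGrp.{u} Jsub))
    (h𝒞 : ClosedUnderInverseLimits 𝒞)
    (S : Set (PartialSortingData Jsub E)) (hne : S.Nonempty)
    (hS : DirectedOn (· ≤ ·) S) (h : ∀ Φ ∈ S, 𝒞 Φ.toSorted) :
    𝒞 (directedUnion S hne hS).toSorted := by
  have : Nonempty S := hne.to_subtype
  have : IsDirectedOrder S := ⟨fun Φ Ψ => by
    obtain ⟨Θ, hΘ, h₁, h₂⟩ := hS Φ.1 Φ.2 Ψ.1 Ψ.2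
    exact ⟨⟨Θ, hΘ⟩, h₁, h₂⟩⟩
  let c : Cone (diagram S) :=
    { pt := (directedUnion S hne hS).toSorted
      π := { app := fun Φ => res (le_directedUnion S hne hS Φ.unop.2)
             naturality := fun Φ Ψ f => by
               simp only [diagram, Functor.const_obj_obj, Functor.const_obj_map, res_comp,
                 Category.id_comp] } }
  have hlift : ∀ s : Cone (diagram S), ∃ l : s.pt ⟶ c.pt, ∀ j, l ≫ c.π.app j = s.π.app j := by
    intro s
    obtain ⟨l, hl⟩ := exists_lift_directedUnion S hne hS (fun Φ => s.π.app (.op Φ))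
      fun Φ Ψ h => s.w (j := .op Ψ) (j' := .op Φ) (homOfLE h).op
    exact ⟨l, fun j => hl j.unop⟩
  choose l hl using hlift
  have huniq : ∀ (s : Cone (diagram S)) (m m' : s.pt ⟶ c.pt),
      (∀ j, m ≫ c.π.app j = m' ≫ c.π.app j) → m = m' := by
    intro s m m' hm
    refine hom_ext fun z => ?_
    obtain ⟨x, hx⟩ := (directedUnion S hne hS).proj_surjective (m.map z * (m'.map z)⁻¹)
    rw [← mul_inv_eq_one, ← hx, proj_eq_one_iff]
    refine kernel_directedUnion S hne hS fun Φ hΦ => ?_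
    rw [← proj_eq_one_iff, ← res_proj (le_directedUnion S hne hS hΦ), hx, map_mul, map_inv,
      mul_inv_eq_one]
    exact congrArg (fun k => k.map z) (hm (.op ⟨Φ, hΦ⟩))
  have hc : IsLimit c := IsLimit.mk l hl fun s m hm =>
    huniq s _ _ fun j => (hm j).trans (hl s j).symm
  have := h𝒞 S
  refine ObjectProperty.IsClosedUnderLimitsOfShape.limitsOfShape_le (P := 𝒞) (J := (S)ᵒᵖ) _
    ⟨{ diag := diagram S, π := c.π, isLimit := hc, prop_diag_obj := fun j => h _ j.unop.2 }⟩

end PartialSortingData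

/-! ### Minimal unsolvable embedding problems. -/

namespace SortedProfiniteGrp

variable {𝒥 : Type v} {Jsub : ℕ → SortTuple 𝒥 → SortTuple 𝒥}

theorem exists_factor_pushforward {X Y : SortedProfiniteGrp.{u} Jsub} {Q : ProfiniteGrp.{u}}
    (f : X.grp →ₜ* Q) (hf : Function.Surjective f) (g : X ⟶ Y)
    (h : ∀ x, f x = 1 → g.map x = 1) :
    ∃ k : X.pushforward f hf ⟶ Y, ∀ x, k.map (f x) = g.map x := by
  obtain ⟨k, hk⟩ := f.exists_factor hf g.map h
  refine ⟨Hom.mk k (fun y => ?_) fun N J hJ => ?_, hk⟩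
  · obtain ⟨x, rfl⟩ := g.surjective y
    exact ⟨f x, hk x⟩
  · have : (N.preimage k).preimage f = N.preimage g.map :=
      SetLike.ext fun x => by simp only [OpenNormalSubgroup.mem_preimage, hk]
    change J ∈ X.data.sorts ((N.preimage k).preimage f)
    rw [this]
    exact g.sorted N hJ

/-- A minimal unsolvable embedding problem without a solution on the level of groups:
every pair of compatible epimorphisms maps onto the fibre product. -/
theorem exists_of_minimal_embedding_problem {X A B : SortedProfiniteGrp.{u} Jsub}
    (hA : Finite A.grp) (hB : Finite B.grp) (χ : X ⟶ A) (π : A ⟶ B) (φ : X ⟶ B)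
    (hmin : ∀ (A' B' : SortedProfiniteGrp.{u} Jsub) (_ : Finite A'.grp) (_ : Finite B'.grp)
      (_ : X ⟶ A') (π' : A' ⟶ B') (φ' : X ⟶ B'),
      Nat.card π'.map.toMonoidHom.ker < Nat.card π.map.toMonoidHom.ker →
        ∃ ψ : X ⟶ A', ψ ≫ π' = φ')
    (hns : ¬ ∃ ψ : X ⟶ A, ψ ≫ π = φ)
    (hs : ¬ ∃ s : X.grp →ₜ* A.grp, Function.Surjective s ∧ ∀ x, π.map (s x) = φ.map x)
    {W : ProfiniteGrp.{u}} (w : W →ₜ* X.grp) (hw : Function.Surjective w)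
    (ψ : W →ₜ* A.grp) (hψ : Function.Surjective ψ) (h : ∀ x, π.map (ψ x) = φ.map (w x))
    (q : X.grp) (a : A.grp) (hqa : φ.map q = π.map a) : ∃ x, w x = q ∧ ψ x = a := by
  -- `V` measures the image of `W` in the fibre product. If it is trivial, `ψ` descends to a group
  -- solution; if it is the whole kernel of `π`, every pair is hit; in between, the problem splits
  -- into two smaller ones.
  let V : Subgroup A.grp := w.toMonoidHom.ker.map ψ.toMonoidHom
  have hVn : V.Normal := (MonoidHom.normal_ker w.toMonoidHom).map ψ.toMonoidHom hψ
  have hVle : V ≤ π.map.toMonoidHom.ker := by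
    rintro _ ⟨x, hx, rfl⟩
    have hx' : w x = 1 := hx
    change π.map (ψ x) = 1
    rw [h, hx', map_one]
  by_cases hbot : V = ⊥
  · refine absurd ?_ hs
    obtain ⟨s, hs⟩ := w.exists_factor hw ψ fun x hx => by
      have : ψ x ∈ V := ⟨x, hx, rfl⟩
      rw [hbot] at this
      exact this
    refine ⟨s, fun a => ?_, fun q => ?_⟩
    · obtain ⟨x, rfl⟩ := hψ a
      exact ⟨w x, hs x⟩
    · obtain ⟨x, rfl⟩ := hw q
      rw [hs, h]
  by_cases htop : π.map.toMonoidHom.ker ≤ V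
  · obtain ⟨x, rfl⟩ := hw q
    have h1 : (ψ x)⁻¹ * a ∈ V := htop (by
      change π.map ((ψ x)⁻¹ * a) = 1
      rw [map_mul, map_inv, h, hqa, inv_mul_cancel])
    obtain ⟨y, hy, hy'⟩ := h1
    have hy₁ : w y = 1 := hy
    have hy₂ : ψ y = (ψ x)⁻¹ * a := hy'
    exact ⟨x * y, by rw [map_mul, hy₁, mul_one], by rw [map_mul, hy₂, mul_inv_cancel_left]⟩
  refine absurd ?_ hns
  have : TotallyDisconnectedSpace (A.grp ⧸ V) :=
    QuotientGroup.totallyDisconnectedSpace V (Set.toFinite _).isClosed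
  let Q : ProfiniteGrp.{u} := ProfiniteGrp.of (A.grp ⧸ V)
  let f : A.grp →ₜ* Q := ⟨QuotientGroup.mk' V, continuous_quotient_mk'⟩
  have hf : Function.Surjective f := QuotientGroup.mk'_surjective V
  have hf1 : ∀ a, f a = 1 ↔ a ∈ V := fun a => QuotientGroup.eq_one_iff a
  have hQ : Finite Q := Finite.of_surjective f hf
  obtain ⟨π', hπ'⟩ := exists_factor_pushforward f hf π fun x hx => hVle ((hf1 x).mp hx)
  -- Solve `A/V ⟶ B` first, then `A ⟶ A/V`. The first kernel is smaller since `V ≠ ⊥`, the second,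
  -- `V`, since it is proper in the kernel of `π`.
  obtain ⟨ψ₁, hψ₁⟩ := hmin _ B hQ hB (χ ≫ A.toPushforward f hf) π' φ (by
    let k : π.map.toMonoidHom.ker → π'.map.toMonoidHom.ker := fun a => ⟨f a.1, by
      change π'.map (f a.1) = 1
      rw [hπ']
      exact a.2⟩
    have hk : Function.Surjective k := by
      rintro ⟨q, hq⟩
      obtain ⟨a, rfl⟩ := hf q
      have hq' : π'.map (f a) = 1 := hq
      rw [hπ'] at hq'
      exact ⟨⟨a, hq'⟩, rfl⟩
    refine lt_of_le_of_ne (Nat.card_le_card_of_surjective k hk) fun hcard => ?_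
    have hinj := ((Nat.bijective_iff_surjective_and_card k).mpr ⟨hk, hcard.symm⟩).1
    refine hbot ((Subgroup.eq_bot_iff_forall _).mpr fun a ha => ?_)
    have := @hinj ⟨a, hVle ha⟩ 1 (Subtype.ext (((hf1 a).mpr ha).trans (map_one f).symm))
    exact congrArg Subtype.val this)
  obtain ⟨ψ₂, hψ₂⟩ := hmin A _ hA hQ χ (A.toPushforward f hf) ψ₁ (by
    have hk : (A.toPushforward f hf).map.toMonoidHom.ker = V := by
      ext a
      exact hf1 a
    rw [hk]
    exact Set.Finite.card_lt_card (Set.toFinite _)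
      (SetLike.coe_ssubset_coe.mpr (lt_of_le_not_ge hVle htop)))
  refine ⟨ψ₂, hom_ext fun x => ?_⟩
  rw [← hψ₁, ← hψ₂, comp_map_apply, comp_map_apply, comp_map_apply]
  exact (hπ' _).symm

end SortedProfiniteGrp

/-! ### Proper extensions and Zorn's lemma. -/

namespace PartialSortingData

open SortedProfiniteGrp

variable {𝒥 : Type v} {Jsub : ℕ → SortTuple 𝒥 → SortTuple 𝒥} [Nonempty (SortTuple 𝒥)]

/-- A proper extension of `Φ` along which epimorphisms from groups with the sorted embedding
property lift, and which preserves membership in `𝒞`. -/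
def IsCoverStep {E : ProfiniteGrp.{u}} (𝒞 : ObjectProperty (SortedProfiniteGrp.{u} Jsub))
    (Φ Φ' : PartialSortingData Jsub E) : Prop :=
  ¬ Φ' ≤ Φ ∧ (𝒞 Φ.toSorted → 𝒞 Φ'.toSorted) ∧ ∃ h : Φ ≤ Φ',
    ∀ Z : SortedProfiniteGrp.{u} Jsub, Z.HasSEP → ∀ r : Z ⟶ Φ.toSorted,
      ∃ r' : Z ⟶ Φ'.toSorted, r' ≫ res h = r

/-- The extension is the fibre product of `Φ.toSorted` and `A` over `A₀`. Both `A` and `A₀` are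
finite quotients of `Φ.toSorted`, so membership in `𝒞` is inherited; `hlift` supplies maps from `Z`
that cover the fibre product. -/
theorem isCoverStep_sup {E : ProfiniteGrp.{u}}
    {𝒞 : ObjectProperty (SortedProfiniteGrp.{u} Jsub)}
    (h𝒞 : ClosedUnderFiniteQuotients 𝒞) (h𝒞' : ClosedUnderFibreProducts 𝒞)
    {Φ : PartialSortingData Jsub E} {A A₀ : SortedProfiniteGrp.{u} Jsub} (hA : Finite A.grp)
    (χ : Φ.toSorted ⟶ A) (π₁ : Φ.toSorted ⟶ A₀) (π₂ : A ⟶ A₀)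
    (ψ : E →ₜ* A.grp) (hψ : Function.Surjective ψ)
    (h : ∀ x, π₁.map (Φ.proj x) = π₂.map (ψ x))
    (hex : ∀ q a, π₁.map q = π₂.map a → ∃ x, Φ.proj x = q ∧ ψ x = a)
    (hlift : ∀ Z : SortedProfiniteGrp.{u} Jsub, Z.HasSEP → ∀ r : Z ⟶ Φ.toSorted,
      ∃ ψZ : Z ⟶ A, (∀ z, π₁.map (r.map z) = π₂.map (ψZ.map z)) ∧
        ∀ q a, π₁.map q = π₂.map a → ∃ z, r.map z = q ∧ ψZ.map z = a)
    (hne : ¬ ofSurjective A ψ hψ ≤ Φ) :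
    IsCoverStep 𝒞 Φ (Φ ⊔ ofSurjective A ψ hψ) := by
  refine ⟨fun hle => hne (le_sup_right.trans hle), fun hΦ => ?_, le_sup_left, fun Z hZ r => ?_⟩
  · obtain ⟨f, hf⟩ := exists_supSnd Φ ψ hψ
    have hA₀ : Finite A₀.grp := Finite.of_surjective π₂.map π₂.surjective
    exact h𝒞' A₀ _ A _ π₁ π₂ _ f (h𝒞 _ _ π₁ hΦ hA₀) hΦ (h𝒞 _ _ χ hΦ hA)
      (isFibreProduct_sup π₁ π₂ h hex f hf)
  · obtain ⟨ψZ, h₁, h₂⟩ := hlift Z hZ r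
    exact exists_lift_sup r ψZ (fun z => hex _ _ (h₁ z)) fun x => h₂ _ _ (h x)

/-- As long as the sorted embedding property fails there is a proper extension. -/
theorem exists_isCoverStep {E : SortedProfiniteGrp.{u} Jsub} (hE : E.HasSEP)
    (hfull : ∀ N, E.data.sorts N = Set.univ)
    {𝒞 : ObjectProperty (SortedProfiniteGrp.{u} Jsub)}
    (h𝒞 : ClosedUnderFiniteQuotients 𝒞) (h𝒞' : ClosedUnderFibreProducts 𝒞)
    (Φ : PartialSortingData Jsub E.grp) (hΦ : ¬ Φ.toSorted.HasSEP) :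
    ∃ Φ', IsCoverStep 𝒞 Φ Φ' := by
  by_contra hno
  refine hΦ ?_
  suffices H : ∀ (n : ℕ) (A B : SortedProfiniteGrp.{u} Jsub) (_ : Finite A.grp)
      (_ : Finite B.grp) (_ : Φ.toSorted ⟶ A) (π : A ⟶ B) (φ : Φ.toSorted ⟶ B),
      Nat.card π.map.toMonoidHom.ker = n → ∃ ψ : Φ.toSorted ⟶ A, ψ ≫ π = φ from
    fun A B hA hB hχ _ π φ => H _ A B hA hB hχ.some π φ rfl
  intro n
  induction n using Nat.strong_induction_on with
  | _ n ih =>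
  rintro A B hA hB χ π φ rfl
  by_contra hns
  let p : E ⟶ Φ.toSorted :=
    Hom.mk Φ.proj Φ.proj_surjective fun N J _ => by rw [hfull]; trivial
  -- a sorted extension of `ψ` to the quotient would solve the problem
  have hne : ∀ (ψ : E.grp →ₜ* A.grp) (hψ : Function.Surjective ψ),
      (∀ x, π.map (ψ x) = φ.map (Φ.proj x)) → ¬ ofSurjective A ψ hψ ≤ Φ := by
    intro ψ hψ hπψ hle
    obtain ⟨f, hf⟩ := exists_hom_of_ofSurjective_le hle
    exact hns ⟨f, hom_ext_proj fun x => by rw [comp_map_apply, hf, hπψ]⟩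
  by_cases hs : ∃ s : Φ.toSorted.grp →ₜ* A.grp,
      Function.Surjective s ∧ ∀ x, π.map (s x) = φ.map x
  · obtain ⟨s, hs, hπs⟩ := hs
    -- `s` fails only to be sorted. Intersecting the data makes `s` a morphism to `A₀`, and the
    -- fibre product with `A` over `A₀` keeps the group while enlarging its data.
    let A₀ := SortedProfiniteGrp.inf A.grp A.data (Φ.toSorted.pushforward s hs).data
    let π₁ : Φ.toSorted ⟶ A₀ := Hom.mk s hs fun _ _ h => h.2
    let π₂ : A ⟶ A₀ :=
      Hom.mk (ContinuousMonoidHom.id A.grp) Function.surjective_id fun _ _ h => h.1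
    refine hno ⟨_, isCoverStep_sup h𝒞 h𝒞' hA χ π₁ π₂ (s.comp Φ.proj)
      (hs.comp Φ.proj_surjective) (fun x => rfl) (fun q a hqa => ?_) (fun Z hZ r => ?_)
      (hne _ _ fun x => hπs _)⟩
    · obtain ⟨x, rfl⟩ := Φ.proj_surjective q
      exact ⟨x, rfl, hqa⟩
    · refine ⟨Hom.mk (s.comp r.map) (hs.comp r.surjective) fun N J hJ => ?_, fun z => rfl,
        fun q a hqa => ?_⟩
      -- `r ≫ χ` is a sorted epimorphism from `Z` onto the same finite group, so SEP makes `s ∘ r`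
      -- sorted as well.
      · exact hZ.sorts_preimage_subset (χ.map.comp r.map) (s.comp r.map)
          (χ.surjective.comp r.surjective) (hs.comp r.surjective) N ((r ≫ χ).sorted N hJ)
      · obtain ⟨z, rfl⟩ := r.surjective q
        exact ⟨z, rfl, hqa⟩
  · have key := fun {W : ProfiniteGrp.{u}} => exists_of_minimal_embedding_problem hA hB χ π φ
      (fun A' B' hA' hB' χ' π' φ' hlt => ih _ hlt A' B' hA' hB' χ' π' φ' rfl) hns hs (W := W)
    -- The problem becomes solvable after inflation to `E`, and later to any `Z` with SEP; `key`
    -- shows that each solution covers the fibre product.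
    obtain ⟨ψ, hψ⟩ := hE A B hA hB ⟨p ≫ χ⟩ ⟨p ≫ φ⟩ π (p ≫ φ)
    have hψ' : ∀ x, π.map (ψ.map x) = φ.map (Φ.proj x) :=
      fun x => congrArg (fun f => Hom.map f x) hψ
    refine hno ⟨_, isCoverStep_sup h𝒞 h𝒞' hA χ φ π ψ.map ψ.surjective (fun x => (hψ' x).symm)
      (key Φ.proj Φ.proj_surjective ψ.map ψ.surjective hψ') (fun Z hZ r => ?_)
      (hne _ _ hψ')⟩
    obtain ⟨ψZ, hψZ⟩ := hZ A B hA hB ⟨r ≫ χ⟩ ⟨r ≫ φ⟩ π (r ≫ φ)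
    have hψZ' : ∀ x, π.map (ψZ.map x) = φ.map (r.map x) :=
      fun x => congrArg (fun f => Hom.map f x) hψZ
    exact ⟨ψZ, fun z => (hψZ' z).symm, key r.map r.surjective ψZ.map ψZ.surjective hψZ'⟩

/-- A stage of the construction of the universal cover: a partial sorting data above `Φ₀` together
with a choice of lifts of all epimorphisms from groups with the sorted embedding property. -/
structure Stage {E : ProfiniteGrp.{u}} (𝒞 : ObjectProperty (SortedProfiniteGrp.{u} Jsub))
    (Φ₀ : PartialSortingData Jsub E) where
  /-- The partial sorting data. -/
  Φ : PartialSortingData Jsub E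
  le : Φ₀ ≤ Φ
  prop : 𝒞 Φ.toSorted
  /-- The lifts. -/
  lift : ∀ Z : SortedProfiniteGrp.{u} Jsub, Z.HasSEP → (Z ⟶ Φ₀.toSorted) → (Z ⟶ Φ.toSorted)
  lift_res : ∀ Z hZ ρ, lift Z hZ ρ ≫ res le = ρ

/-- Lifts need not be unique, so the order also asks the chosen lifts to be compatible; only then do
they pass to the limit of a chain. -/
instance {E : ProfiniteGrp.{u}} (𝒞 : ObjectProperty (SortedProfiniteGrp.{u} Jsub))
    (Φ₀ : PartialSortingData Jsub E) : Preorder (Stage 𝒞 Φ₀) where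
  le s t := ∃ h : s.Φ ≤ t.Φ, ∀ Z hZ ρ, t.lift Z hZ ρ ≫ res h = s.lift Z hZ ρ
  le_refl s := ⟨le_rfl, fun Z hZ ρ => by rw [res_refl, Category.comp_id]⟩
  le_trans s t w := by
    rintro ⟨h, hst⟩ ⟨h', htw⟩
    exact ⟨h.trans h', fun Z hZ ρ => by
      rw [← res_comp h h', ← Category.assoc, htw, hst]⟩

theorem Stage.bddAbove_of_isChain {E : ProfiniteGrp.{u}}
    {𝒞 : ObjectProperty (SortedProfiniteGrp.{u} Jsub)} (h𝒞 : ClosedUnderInverseLimits 𝒞)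
    {Φ₀ : PartialSortingData Jsub E} (c : Set (Stage 𝒞 Φ₀)) (hc : IsChain (· ≤ ·) c)
    (hne : c.Nonempty) : BddAbove c := by
  let S : Set (PartialSortingData Jsub E) := Stage.Φ '' c
  have hS : DirectedOn (· ≤ ·) S := by
    rintro _ ⟨s, hs, rfl⟩ _ ⟨t, ht, rfl⟩
    obtain ⟨w, hw, hsw, htw⟩ := hc.directedOn s hs t ht
    exact ⟨w.Φ, ⟨w, hw, rfl⟩, hsw.1, htw.1⟩
  have hSne : S.Nonempty := hne.image _
  choose st hst hstΦ using fun Φ : S => Φ.2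
  have hlift : ∀ Z (hZ : Z.HasSEP) (ρ : Z ⟶ Φ₀.toSorted),
      ∃ l : Z ⟶ (directedUnion S hSne hS).toSorted, ∀ (s : Stage 𝒞 Φ₀) (hs : s ∈ c),
        l ≫ res (le_directedUnion S hSne hS ⟨s, hs, rfl⟩) = s.lift Z hZ ρ := by
    intro Z hZ ρ
    -- `s.Φ ≤ t.Φ` alone does not give `s ≤ t`, so both lifts are compared with that of a common
    -- upper stage.
    have hcomp : ∀ s ∈ c, ∀ t ∈ c, ∀ h : s.Φ ≤ t.Φ,
        t.lift Z hZ ρ ≫ res h = s.lift Z hZ ρ := by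
      intro s hs t ht h
      obtain ⟨w, hw, ⟨hsw, hsw'⟩, htw, htw'⟩ := hc.directedOn s hs t ht
      rw [← hsw', ← htw', Category.assoc, res_comp]
    have hex : ∀ Φ : S, ∃ r : Z ⟶ Φ.1.toSorted, ∀ s ∈ c, ∀ h : s.Φ ≤ Φ.1,
        r ≫ res h = s.lift Z hZ ρ := by
      rintro ⟨_, t, ht, rfl⟩
      exact ⟨t.lift Z hZ ρ, fun s hs h => hcomp s hs t ht h⟩
    choose r hr using hex
    have hr' : ∀ s (hs : s ∈ c), r ⟨s.Φ, s, hs, rfl⟩ = s.lift Z hZ ρ := fun s hs => by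
      rw [← hr ⟨s.Φ, s, hs, rfl⟩ s hs le_rfl, res_refl, Category.comp_id]
    obtain ⟨l, hl⟩ := exists_lift_directedUnion S hSne hS r (by
      rintro ⟨_, s, hs, rfl⟩ Ψ h
      rw [hr Ψ s hs h, hr' s hs])
    exact ⟨l, fun s hs => (hl ⟨s.Φ, s, hs, rfl⟩).trans (hr' s hs)⟩
  choose l hl using hlift
  obtain ⟨s₀, hs₀⟩ := hne
  refine ⟨{ Φ := directedUnion S hSne hS
            le := s₀.le.trans (le_directedUnion S hSne hS ⟨s₀, hs₀, rfl⟩)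
            prop := prop_directedUnion 𝒞 h𝒞 S hSne hS (by rintro _ ⟨s, -, rfl⟩; exact s.prop)
            lift := l
            lift_res := fun Z hZ ρ => ?_ }, fun s hs => ⟨le_directedUnion S hSne hS ⟨s, hs, rfl⟩,
            fun Z hZ ρ => hl Z hZ ρ s hs⟩⟩
  rw [← res_comp s₀.le (le_directedUnion S hSne hS ⟨s₀, hs₀, rfl⟩), ← Category.assoc,
    hl Z hZ ρ s₀ hs₀, s₀.lift_res]

/-- Every quotient of a group with the sorted embedding property and maximal sorting data has a
universal cover between it and that group. -/
theorem exists_universal_above {E : SortedProfiniteGrp.{u} Jsub} (hE : E.HasSEP)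
    (hfull : ∀ N, E.data.sorts N = Set.univ)
    {𝒞 : ObjectProperty (SortedProfiniteGrp.{u} Jsub)}
    (h𝒞 : ClosedUnderFiniteQuotients 𝒞) (h𝒞' : ClosedUnderFibreProducts 𝒞)
    (h𝒞'' : ClosedUnderInverseLimits 𝒞) (Φ₀ : PartialSortingData Jsub E.grp)
    (hΦ₀ : 𝒞 Φ₀.toSorted) :
    ∃ (Φ : PartialSortingData Jsub E.grp) (p : Φ.toSorted ⟶ Φ₀.toSorted),
      𝒞 Φ.toSorted ∧ IsUniversalSEPCover p := by
  have : Nonempty (Stage 𝒞 Φ₀) :=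
    ⟨Φ₀, le_rfl, hΦ₀, fun _ _ ρ => ρ, fun _ _ ρ => by rw [res_refl, Category.comp_id]⟩
  obtain ⟨s, hs⟩ := zorn_le_nonempty (α := Stage 𝒞 Φ₀)
    (fun c hc hne => Stage.bddAbove_of_isChain h𝒞'' c hc hne)
  refine ⟨s.Φ, res s.le, s.prop, ?_, fun Z r hZ => ⟨s.lift Z hZ r, s.lift_res Z hZ r⟩⟩
  by_contra hSEP
  obtain ⟨Φ', hne, hΦ', hle, hlift⟩ := exists_isCoverStep hE hfull h𝒞 h𝒞' s.Φ hSEP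
  choose l hl using hlift
  let t : Stage 𝒞 Φ₀ :=
    { Φ := Φ'
      le := s.le.trans hle
      prop := hΦ' s.prop
      lift := fun Z hZ ρ => l Z hZ (s.lift Z hZ ρ)
      lift_res := fun Z hZ ρ => by
        rw [← res_comp s.le hle, ← Category.assoc, hl, s.lift_res] }
  exact hne (hs (show s ≤ t from ⟨hle, fun Z hZ ρ => hl Z hZ _⟩)).1

end PartialSortingData

/-! ### Lifting generating families along epimorphisms of finite groups. -/

section Gaschutz

variable {A B α : Type*} [Group A] [Group B] [Finite A]

open Classical in
/-- The number of lifts of a generating tuple along an epimorphism of finite groups that generate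
a given subgroup does not depend on the generating tuple. -/
theorem MonoidHom.card_generating_lifts_eq [Fintype (α → A)] (π : A →* B) (C : Subgroup A)
    (b b' : α → B) (hb : Subgroup.closure (Set.range b) = ⊤)
    (hb' : Subgroup.closure (Set.range b') = ⊤) :
    (Finset.univ.filter fun a : α → A =>
      π ∘ a = b ∧ Subgroup.closure (Set.range a) = C).card =
    (Finset.univ.filter fun a : α → A =>
      π ∘ a = b' ∧ Subgroup.closure (Set.range a) = C).card := by
  induction h : Nat.card C using Nat.strong_induction_on generalizing C with
  | _ n ih =>
  subst h
  have hmap : ∀ (c : α → B) (a : α → A), π ∘ a = c → Subgroup.closure (Set.range c) = ⊤ →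
      (Subgroup.closure (Set.range a)).map π = ⊤ := by
    rintro c a rfl hc
    rw [MonoidHom.map_closure, ← Set.range_comp, hc]
  by_cases hC : C.map π = ⊤
  swap
  · have hz : ∀ c : α → B, Subgroup.closure (Set.range c) = ⊤ →
        (Finset.univ.filter fun a : α → A =>
          π ∘ a = c ∧ Subgroup.closure (Set.range a) = C) = ∅ := by
      intro c hc
      refine Finset.filter_eq_empty_iff.mpr fun a _ ha => hC ?_
      rw [← ha.2]
      exact hmap c a ha.1 hc
    rw [hz b hb, hz b' hb']
  let _ : Fintype (Subgroup A) := Fintype.ofFinite _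
  let T : (α → B) → Finset (α → A) := fun c =>
    Finset.univ.filter fun a => π ∘ a = c ∧ Subgroup.closure (Set.range a) ≤ C
  -- Since `C` maps onto `B`, multiplying by fixed representatives in `C` turns lifts of `c` inside
  -- `C` injectively into lifts of `c'`.
  have hle : ∀ c c' : α → B, (T c).card ≤ (T c').card := by
    intro c c'
    have hlift : ∀ y : B, ∃ x ∈ C, π x = y := fun y => by
      have : y ∈ C.map π := hC ▸ Subgroup.mem_top y
      exact this
    choose l hl hl' using hlift
    refine Finset.card_le_card_of_injOn (fun a i => a i * (l (c i))⁻¹ * l (c' i)) ?_ ?_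
    · intro a ha
      obtain ⟨-, rfl, haC⟩ := Finset.mem_filter.mp ha
      refine Finset.mem_filter.mpr ⟨Finset.mem_univ _, ?_, ?_⟩
      · ext i
        simp [hl']
      · rw [Subgroup.closure_le] at haC ⊢
        rintro _ ⟨i, rfl⟩
        exact C.mul_mem (C.mul_mem (haC ⟨i, rfl⟩) (C.inv_mem (hl _))) (hl _)
    · intro a _ a' _ h
      ext i
      simpa using congrFun h i
  -- Sort the lifts inside `C` by the subgroup they generate. The totals agree, and so do the terms
  -- for proper subgroups by induction, which leaves the term for `C`.
  have hsum : ∀ c : α → B, (T c).card =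
      ∑ D ∈ (Finset.univ.filter fun D : Subgroup A => D ≤ C),
        (Finset.univ.filter fun a : α → A =>
          π ∘ a = c ∧ Subgroup.closure (Set.range a) = D).card := by
    intro c
    rw [Finset.card_eq_sum_card_fiberwise (f := fun a : α → A => Subgroup.closure (Set.range a))
      (t := Finset.univ.filter fun D : Subgroup A => D ≤ C)]
    · refine Finset.sum_congr rfl fun D hD => ?_
      congr 1
      ext a
      simp only [T, Finset.mem_filter, Finset.mem_univ, true_and]
      constructor
      · rintro ⟨⟨h1, -⟩, h2⟩
        exact ⟨h1, h2⟩
      · rintro ⟨h1, h2⟩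
        exact ⟨⟨h1, h2 ▸ (Finset.mem_filter.mp hD).2⟩, h2⟩
    · intro a ha
      have := (Finset.mem_filter.mp ha).2.2
      simpa using this
  have hmem : C ∈ (Finset.univ.filter fun D : Subgroup A => D ≤ C) := by simp
  have h1 := hsum b
  have h2 := hsum b'
  rw [le_antisymm (hle b b') (hle b' b), h2, ← Finset.add_sum_erase _ _ hmem,
    ← Finset.add_sum_erase _ _ hmem] at h1
  have h3 : ∀ D ∈ (Finset.univ.filter fun D : Subgroup A => D ≤ C).erase C,
      (Finset.univ.filter fun a : α → A =>
        π ∘ a = b ∧ Subgroup.closure (Set.range a) = D).card =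
      (Finset.univ.filter fun a : α → A =>
        π ∘ a = b' ∧ Subgroup.closure (Set.range a) = D).card := by
    intro D hD
    obtain ⟨hne, hD⟩ := Finset.mem_erase.mp hD
    have hlt : D < C := lt_of_le_of_ne (Finset.mem_filter.mp hD).2 hne
    exact ih _ (Set.Finite.card_lt_card (Set.toFinite _) (SetLike.coe_ssubset_coe.mpr hlt)) D rfl
  rw [Finset.sum_congr rfl h3] at h1
  exact (Nat.add_right_cancel h1).symm

/-- Gaschütz' lemma: generating tuples lift along epimorphisms of finite groups. -/
theorem MonoidHom.exists_generating_lift [Finite α] (π : A →* B) (hπ : Function.Surjective π)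
    (a' : α → A) (ha' : Subgroup.closure (Set.range a') = ⊤)
    (b : α → B) (hb : Subgroup.closure (Set.range b) = ⊤) :
    ∃ a : α → A, (∀ i, π (a i) = b i) ∧ Subgroup.closure (Set.range a) = ⊤ := by
  classical
  let _ : Fintype (α → A) := Fintype.ofFinite _
  -- The tuple `π ∘ a'` has a generating lift, namely `a'`; equality of the counts gives one for
  -- `b`.
  have hb' : Subgroup.closure (Set.range (π ∘ a')) = ⊤ := by
    rw [Set.range_comp, ← MonoidHom.map_closure, ha', Subgroup.map_top_of_surjective π hπ]
  have h := π.card_generating_lifts_eq ⊤ b (π ∘ a') hb hb'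
  have hpos : 0 < (Finset.univ.filter fun a : α → A =>
      π ∘ a = b ∧ Subgroup.closure (Set.range a) = ⊤).card := by
    rw [h]
    exact Finset.card_pos.mpr ⟨a', by simp [ha']⟩
  obtain ⟨a, ha⟩ := Finset.card_pos.mp hpos
  obtain ⟨-, h1, h2⟩ := Finset.mem_filter.mp ha
  exact ⟨a, fun i => congrFun h1 i, h2⟩

end Gaschutz

/-- Generating families indexed by an infinite set lift along epimorphisms of finite groups. -/
theorem MonoidHom.exists_generating_lift_of_infinite {A B α : Type*} [Group A] [Group B]
    [Finite A] [Infinite α] (π : A →* B) (hπ : Function.Surjective π)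
    (b : α → B) (hb : Subgroup.closure (Set.range b) = ⊤) :
    ∃ a : α → A, (∀ i, π (a i) = b i) ∧ Subgroup.closure (Set.range a) = ⊤ := by
  classical
  have : Finite B := Finite.of_surjective π hπ
  obtain ⟨y, hy⟩ := Finite.exists_infinite_fiber b
  choose s hs using hπ
  let S := {x : A // π x = y}
  have : Nonempty S := ⟨⟨s y, hs y⟩⟩
  -- On the infinite fibre over `y` there is room for `a` to run through all of `π⁻¹(y)`; quotients
  -- of these elements fill the kernel of `π`.
  let j : S ↪ b ⁻¹' {y} :=
    (Finite.equivFin S).toEmbedding.trans (Fin.valEmbedding.trans (Infinite.natEmbedding _))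
  let t : b ⁻¹' {y} → S := Function.invFun j
  have ht : ∀ x, t (j x) = x := Function.leftInverse_invFun j.injective
  let a : α → A := fun i => if h : b i = y then (t ⟨i, h⟩).1 else s (b i)
  have ha : ∀ i, π (a i) = b i := by
    intro i
    by_cases h : b i = y
    · simp only [a, h, dite_true]
      exact (t ⟨i, h⟩).2
    · simp only [a, h, dite_false, hs]
  refine ⟨a, ha, ?_⟩
  have hfib : ∀ x, π x = y → x ∈ Subgroup.closure (Set.range a) := by
    intro x hx
    refine Subgroup.subset_closure ⟨(j ⟨x, hx⟩).1, ?_⟩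
    have h : b (j ⟨x, hx⟩).1 = y := (j ⟨x, hx⟩).2
    simp only [a, h, dite_true]
    exact congrArg Subtype.val (ht ⟨x, hx⟩)
  have hker : ∀ x, π x = 1 → x ∈ Subgroup.closure (Set.range a) := by
    intro x hx
    have h1 := Subgroup.mul_mem _ (Subgroup.inv_mem _ (hfib (s y) (hs y)))
      (hfib (s y * x) (by rw [map_mul, hs, hx, mul_one]))
    simpa using h1
  refine eq_top_iff.mpr fun x _ => ?_
  have hmap : (Subgroup.closure (Set.range a)).map π = ⊤ := by
    rw [MonoidHom.map_closure, ← Set.range_comp, show π ∘ a = b from funext ha, hb]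
  obtain ⟨z, hz, hzx⟩ : π x ∈ (Subgroup.closure (Set.range a)).map π := hmap ▸ Subgroup.mem_top _
  have h1 := Subgroup.mul_mem _ hz (hker (z⁻¹ * x) (by rw [map_mul, map_inv, hzx, inv_mul_cancel]))
  simpa using h1

/-! ### Free profinite groups and the Hopf property. -/

namespace ProfiniteGrp

/-- Free profinite groups exist. -/
theorem exists_free (α : Type u) : ∃ (F : ProfiniteGrp.{u}) (ι : α → F),
    Dense (Subgroup.closure (Set.range ι) : Set F) ∧
      ∀ (P : ProfiniteGrp.{u}) (g : α → P), ∃ f : F →ₜ* P, ∀ i, f (ι i) = g i := by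
  let G := GrpCat.of (FreeGroup α)
  let F := ProfiniteCompletion.completion G
  let η : FreeGroup α →* F := (ProfiniteCompletion.eta G).hom
  refine ⟨F, fun i => η (FreeGroup.of i), ?_, fun P g => ?_⟩
  · have h1 : Subgroup.closure (Set.range fun i => η (FreeGroup.of i)) = η.range := by
      have h2 := MonoidHom.map_closure η (Set.range (FreeGroup.of : α → FreeGroup α))
      rw [FreeGroup.closure_range_of, ← Set.range_comp, ← MonoidHom.range_eq_map] at h2
      exact h2.symm
    rw [h1]
    exact ProfiniteCompletion.denseRange G
  · let k : G ⟶ GrpCat.of P := GrpCat.ofHom (FreeGroup.lift g)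
    refine ⟨(ProfiniteCompletion.lift k).hom, fun i => ?_⟩
    have h := ConcreteCategory.congr_hom (ProfiniteCompletion.lift_eta k) (FreeGroup.of i)
    refine Eq.trans h ?_
    exact FreeGroup.lift_apply_of

theorem eq_of_dense_closure {F P : ProfiniteGrp.{u}} {S : Set F}
    (hS : Dense (Subgroup.closure S : Set F)) {f g : F →ₜ* P} (h : ∀ s ∈ S, f s = g s) :
    f = g := by
  have h1 : Set.EqOn f g (Subgroup.closure S : Set F) := fun x hx =>
    MonoidHom.eqOn_closure (f := f.toMonoidHom) (g := g.toMonoidHom) h hx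
  have h2 := Continuous.ext_on hS f.continuous_toFun g.continuous_toFun h1
  exact DFunLike.coe_injective h2

theorem surjective_of_dense_closure {F P : ProfiniteGrp.{u}} (f : F →ₜ* P) {S : Set F}
    (hS : Dense (Subgroup.closure (f '' S) : Set P)) : Function.Surjective f := by
  have hcl : IsClosed (Set.range f) := (isCompact_range f.continuous_toFun).isClosed
  have hle : (Subgroup.closure (f '' S) : Set P) ⊆ Set.range f := by
    have : Subgroup.closure (f '' S) ≤ f.toMonoidHom.range :=
      (Subgroup.closure_le _).mpr (by rintro _ ⟨x, -, rfl⟩; exact ⟨x, rfl⟩)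
    exact this
  exact Set.range_eq_univ.mp (hcl.closure_eq ▸ (hS.mono hle).closure_eq)

theorem dense_closure_image {F P : ProfiniteGrp.{u}} (f : F →ₜ* P) (hf : Function.Surjective f)
    {S : Set F} (hS : Dense (Subgroup.closure S : Set F)) :
    Dense (Subgroup.closure (f '' S) : Set P) := by
  have h1 := hf.denseRange.dense_image f.continuous_toFun hS
  have h2 := MonoidHom.map_closure f.toMonoidHom S
  have h3 : ((Subgroup.closure S).map f.toMonoidHom : Set P) = f '' Subgroup.closure S := rfl
  rw [← h3, h2] at h1
  exact h1

theorem closure_eq_top_of_dense {P : ProfiniteGrp.{u}} [Finite P] {S : Set P}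
    (hS : Dense (Subgroup.closure S : Set P)) : Subgroup.closure S = ⊤ :=
  SetLike.coe_injective ((Set.toFinite _).isClosed.closure_eq.symm.trans hS.closure_eq)

/-- Topologically finitely generated profinite groups are Hopfian. -/
theorem injective_of_surjective {G : ProfiniteGrp.{u}} {S : Set G} (hfin : S.Finite)
    (hS : Dense (Subgroup.closure S : Set G)) (f : G →ₜ* G) (hf : Function.Surjective f) :
    Function.Injective f := by
  refine (injective_iff_map_eq_one _).mpr fun x hx =>
    SortedProfiniteGrp.eq_one_of_forall_mem fun N => ?_
  have : TotallyDisconnectedSpace (G ⧸ (N : Subgroup G)) :=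
    QuotientGroup.totallyDisconnectedSpace _ N.toOpenSubgroup.isClosed
  let Q : ProfiniteGrp.{u} := ProfiniteGrp.of (G ⧸ (N : Subgroup G))
  have : Finite Q := inferInstanceAs (Finite (G ⧸ N.toOpenSubgroup.toSubgroup))
  let q : G →ₜ* Q := ⟨QuotientGroup.mk' (N : Subgroup G), continuous_quotient_mk'⟩
  have hSf : Finite S := hfin
  -- Precomposition with `f` is an injective self-map of this finite set, hence surjective; so `q`
  -- factors through `f` and the kernel of `f` lies in `N`.
  have : Finite (G →ₜ* Q) := Finite.of_injective (fun (g : G →ₜ* Q) (s : S) => g s)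
    fun g g' h => eq_of_dense_closure hS fun s hs => congrFun h ⟨s, hs⟩
  have hinj : Function.Injective fun g : G →ₜ* Q => g.comp f := by
    intro g g' h
    refine ContinuousMonoidHom.ext fun y => ?_
    obtain ⟨z, rfl⟩ := hf y
    exact congrArg (fun k : G →ₜ* Q => k z) h
  obtain ⟨g, hg⟩ := Finite.surjective_of_injective hinj q
  have h1 : q x = g (f x) := (congrArg (fun k : G →ₜ* Q => k x) hg).symm
  rw [hx, map_one] at h1
  exact (QuotientGroup.eq_one_iff x).mp h1

end ProfiniteGrp

/-! ### Free covers, existence and uniqueness. -/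

namespace SortedProfiniteGrp

variable {𝒥 : Type v} {Jsub : ℕ → SortTuple 𝒥 → SortTuple 𝒥}

/-- A profinite group with the largest sorting data. -/
abbrev full [Nonempty (SortTuple 𝒥)] (Jsub : ℕ → SortTuple 𝒥 → SortTuple 𝒥)
    (G : ProfiniteGrp.{u}) : SortedProfiniteGrp.{u} Jsub where
  grp := G
  data := PartialSortingData.toSortingData
    (PartialSortingData.above Jsub ⊥) fun N =>
      ⟨Classical.arbitrary _, show ⊥ ≤ (N : Subgroup G) from bot_le⟩

theorem full_sorts [Nonempty (SortTuple 𝒥)] (G : ProfiniteGrp.{u}) (N) :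
    (full Jsub G).data.sorts N = Set.univ :=
  Set.eq_univ_of_forall fun _ => show ⊥ ≤ (N : Subgroup G) from bot_le

/-- A free profinite group with the largest sorting data has the sorted embedding property if
generating families lift. -/
theorem hasSEP_full [Nonempty (SortTuple 𝒥)] {α : Type u} {F : ProfiniteGrp.{u}} (ι : α → F)
    (hι : Dense (Subgroup.closure (Set.range ι) : Set F))
    (hF : ∀ (P : ProfiniteGrp.{u}) (g : α → P), ∃ f : F →ₜ* P, ∀ i, f (ι i) = g i)
    (hlift : ∀ (A B : ProfiniteGrp.{u}) (_ : Finite A) (_ : Finite B) (π : A →* B)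
      (_ : Function.Surjective π) (a' : α → A) (_ : Subgroup.closure (Set.range a') = ⊤)
      (b : α → B) (_ : Subgroup.closure (Set.range b) = ⊤),
      ∃ a : α → A, (∀ i, π (a i) = b i) ∧ Subgroup.closure (Set.range a) = ⊤) :
    (full Jsub F).HasSEP := by
  rintro A B hA hB ⟨χ⟩ - π φ
  have hgen : ∀ {C : SortedProfiniteGrp.{u} Jsub} [Finite C.grp] (f : full Jsub F ⟶ C),
      Subgroup.closure (Set.range fun i => f.map (ι i)) = ⊤ := by
    intro C _ f
    have := ProfiniteGrp.closure_eq_top_of_dense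
      (ProfiniteGrp.dense_closure_image f.map f.surjective hι)
    rwa [← Set.range_comp] at this
  -- The quotient map `χ` supplies the generating family of `A` that Gaschütz' lemma requires.
  obtain ⟨a, ha, ha'⟩ := hlift A.grp B.grp hA hB π.map.toMonoidHom π.surjective _ (hgen χ) _
    (hgen φ)
  obtain ⟨f, hf⟩ := hF A.grp a
  have hfs : Function.Surjective f := by
    refine ProfiniteGrp.surjective_of_dense_closure f (S := Set.range ι) ?_
    rw [← Set.range_comp, show f ∘ ι = a from funext hf, ha']
    exact dense_univ
  refine ⟨Hom.mk f hfs fun N J _ => by rw [full_sorts]; trivial, Hom.ext ?_⟩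
  refine ProfiniteGrp.eq_of_dense_closure hι ?_
  rintro _ ⟨i, rfl⟩
  change π.map (f (ι i)) = φ.map (ι i)
  rw [hf]
  exact ha i

/-- Every sorted profinite group is a quotient of a group with the sorted embedding property and
maximal sorting data. -/
theorem exists_full_cover (X : SortedProfiniteGrp.{u} Jsub) :
    ∃ (E : SortedProfiniteGrp.{u} Jsub) (_ : E ⟶ X),
      E.HasSEP ∧ ∀ N, E.data.sorts N = Set.univ := by
  have := X.nonempty_sortTuple
  -- The first summand makes the map to `X` onto; the second makes the index set infinite even when
  -- `X` is finite.
  let α := X.grp ⊕ ULift.{u} ℕ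
  obtain ⟨F, ι, hι, hF⟩ := ProfiniteGrp.exists_free α
  obtain ⟨f, hf⟩ := hF X.grp (Sum.elim id fun _ => 1)
  refine ⟨full Jsub F, Hom.mk f (fun x => ⟨ι (Sum.inl x), hf _⟩) fun N J _ => ?_,
    hasSEP_full ι hι hF ?_, full_sorts F⟩
  · rw [full_sorts]
    trivial
  · intro A B _ _ π hπ _ _ b hb
    exact π.exists_generating_lift_of_infinite hπ b hb

theorem exists_finitelyGenerated_cover (X : SortedProfiniteGrp.{u} Jsub)
    (hX : X.IsFinitelyGenerated) :
    ∃ (E : SortedProfiniteGrp.{u} Jsub) (_ : E ⟶ X), E.HasSEP ∧ E.IsFinitelyGenerated := by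
  classical
  have := X.nonempty_sortTuple
  obtain ⟨S, hS⟩ := hX
  obtain ⟨F, ι, hι, hF⟩ := ProfiniteGrp.exists_free S
  obtain ⟨f, hf⟩ := hF X.grp Subtype.val
  have hfs : Function.Surjective f := by
    refine ProfiniteGrp.surjective_of_dense_closure f (S := Set.range ι) ?_
    rw [← Set.range_comp, show f ∘ ι = Subtype.val from funext hf, Subtype.range_coe]
    exact hS
  refine ⟨full Jsub F, Hom.mk f hfs fun N J _ => ?_, hasSEP_full ι hι hF ?_,
    Finset.univ.image ι, ?_⟩
  · rw [full_sorts]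
    trivial
  · intro A B _ _ π hπ a' ha' b hb
    exact π.exists_generating_lift hπ a' ha' b hb
  · rw [Finset.coe_image, Finset.coe_univ, Set.image_univ]
    exact hι

theorem IsFinitelyGenerated.of_hom {X Y : SortedProfiniteGrp.{u} Jsub}
    (hX : X.IsFinitelyGenerated) (f : X ⟶ Y) : Y.IsFinitelyGenerated := by
  classical
  obtain ⟨S, hS⟩ := hX
  refine ⟨S.image f.map, ?_⟩
  rw [Finset.coe_image]
  exact ProfiniteGrp.dense_closure_image f.map f.surjective hS

/-- A bijective morphism that does not enlarge the sorting data is an isomorphism. -/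
theorem exists_iso_of_injective {X Y : SortedProfiniteGrp.{u} Jsub} (f : X ⟶ Y)
    (hf : Function.Injective f.map)
    (h : ∀ N, X.data.sorts (N.preimage f.map) ⊆ Y.data.sorts N) :
    ∃ e : X ≅ Y, e.hom = f := by
  obtain ⟨k, hk⟩ := f.map.exists_factor f.surjective (ContinuousMonoidHom.id X.grp) fun x hx =>
    hf (hx.trans (map_one f.map).symm)
  have hk' : ∀ x, k (f.map x) = x := hk
  have hsorted : ∀ N, X.data.sorts N ⊆ Y.data.sorts (N.preimage k) := fun N J hJ => by
    refine h _ ?_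
    have : (N.preimage k).preimage f.map = N :=
      SetLike.ext fun x => by simp only [OpenNormalSubgroup.mem_preimage, hk']
    rwa [this]
  refine ⟨⟨f, Hom.mk k (fun x => ⟨_, hk x⟩) hsorted, hom_ext hk, hom_ext fun y => ?_⟩, rfl⟩
  obtain ⟨x, rfl⟩ := f.surjective y
  exact congrArg f.map (hk x)

/-- An object isomorphic to `Y` is a fibre product of `Y` with itself over `Y`. -/
theorem ClosedUnderFibreProducts.prop_of_iso
    {𝒞 : ObjectProperty (SortedProfiniteGrp.{u} Jsub)} (h𝒞 : ClosedUnderFibreProducts 𝒞)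
    {X Y : SortedProfiniteGrp.{u} Jsub} (e : X ≅ Y) (hY : 𝒞 Y) : 𝒞 X := by
  have he : ∀ x, e.inv.map (e.hom.map x) = x :=
    fun x => congrArg (fun f => Hom.map f x) e.hom_inv_id
  refine h𝒞 Y Y Y X (𝟙 Y) (𝟙 Y) e.hom e.hom hY hY hY ⟨rfl, ?_, fun F hF _ N J hJ => ?_⟩
  · rintro y _ rfl
    obtain ⟨x, rfl⟩ := e.hom.surjective y
    refine ⟨x, ⟨rfl, rfl⟩, fun z hz => ?_⟩
    rw [← he z, hz.1]
    exact he x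
  · have := hF _ (e.inv.sorted N hJ)
    have hN : (N.preimage e.inv.map).preimage e.hom.map = N :=
      SetLike.ext fun x => by simp only [OpenNormalSubgroup.mem_preimage, he]
    rwa [hN] at this

theorem exists_universalSEPCover {𝒞 : ObjectProperty (SortedProfiniteGrp.{u} Jsub)}
    (h𝒞 : ClosedUnderFiniteQuotients 𝒞) (h𝒞' : ClosedUnderFibreProducts 𝒞)
    (h𝒞'' : ClosedUnderInverseLimits 𝒞) (X : SortedProfiniteGrp.{u} Jsub) (hX : 𝒞 X) :
    ∃ (Y : SortedProfiniteGrp.{u} Jsub) (p : Y ⟶ X), 𝒞 Y ∧ IsUniversalSEPCover p := by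
  have := X.nonempty_sortTuple
  obtain ⟨E, e, hE, hfull⟩ := X.exists_full_cover
  let Φ₀ := PartialSortingData.ofSurjective X e.map e.surjective
  obtain ⟨f, hf⟩ := PartialSortingData.exists_hom_of_ofSurjective_le (le_refl Φ₀)
  obtain ⟨i, hi⟩ := exists_iso_of_injective f
    ((injective_iff_map_eq_one _).mpr fun q hq => by
      obtain ⟨x, rfl⟩ := Φ₀.proj_surjective q
      rw [hf] at hq
      exact PartialSortingData.proj_eq_one_iff.mpr (PartialSortingData.kernel_of_le_above
        (PartialSortingData.ofSurjective_le_above X e.map e.surjective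
          (K := e.map.toMonoidHom.ker) fun x hx => hx) hq))
    fun N J hJ => by
      obtain ⟨M, hM, hJ'⟩ := hJ
      have : M.preimage e.map = N.preimage e.map := hM.trans
        (SetLike.ext fun x => by
          change f.map (Φ₀.proj x) ∈ N ↔ e.map x ∈ N
          rw [hf])
      rwa [OpenNormalSubgroup.preimage_injective _ e.surjective this] at hJ'
  obtain ⟨Φ, p, hΦ, hSEP, huniv⟩ := PartialSortingData.exists_universal_above hE hfull h𝒞 h𝒞' h𝒞''
    Φ₀ (h𝒞'.prop_of_iso i hX)
  refine ⟨Φ.toSorted, p ≫ i.hom, hΦ, hSEP, fun Z r hZ => ?_⟩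
  obtain ⟨q, hq⟩ := huniv Z (r ≫ i.inv) hZ
  exact ⟨q, by rw [← Category.assoc, hq, Category.assoc, i.inv_hom_id, Category.comp_id]⟩

/-- With the sorted embedding property, surjective endomorphisms preserve the sorting data. -/
theorem HasSEP.sorts_preimage_endo_subset {Y : SortedProfiniteGrp.{u} Jsub} (hY : Y.HasSEP)
    (h : Y.grp →ₜ* Y.grp) (hh : Function.Surjective h) (N : OpenNormalSubgroup Y.grp) :
    Y.data.sorts (N.preimage h) ⊆ Y.data.sorts N := by
  have : TotallyDisconnectedSpace (Y.grp ⧸ (N : Subgroup Y.grp)) :=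
    QuotientGroup.totallyDisconnectedSpace _ N.toOpenSubgroup.isClosed
  let Q : ProfiniteGrp.{u} := ProfiniteGrp.of (Y.grp ⧸ (N : Subgroup Y.grp))
  have : Finite Q := inferInstanceAs (Finite (Y.grp ⧸ N.toOpenSubgroup.toSubgroup))
  let q : Y.grp →ₜ* Q := ⟨QuotientGroup.mk' (N : Subgroup Y.grp), continuous_quotient_mk'⟩
  have hq : Function.Surjective q := QuotientGroup.mk'_surjective _
  have hN := N.preimage_image q hq (q.isOpenMap_of_surjective hq) fun x hx =>
    (QuotientGroup.eq_one_iff x).mp hx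
  -- `N` and its preimage under `h` are the kernels of two epimorphisms onto the same finite group.
  have := hY.sorts_preimage_subset (q.comp h) q (hq.comp hh) hq
    (N.image q hq (q.isOpenMap_of_surjective hq))
  rw [hN] at this
  refine subset_trans (Eq.subset ?_) this
  conv_lhs => rw [← hN]
  rfl

/-- The Hopf property makes `q ≫ q'`, hence `q`, injective. A tuple at the `q`-preimage of `N` moves
along `q'` to the preimage of `N` under the endomorphism `q' ≫ q` of `Y₂`, where SEP brings it back
to `N`. -/
theorem exists_iso_of_hom_of_hom {Y₁ Y₂ : SortedProfiniteGrp.{u} Jsub} (h₂ : Y₂.HasSEP)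
    (hfg : Y₁.IsFinitelyGenerated) (q : Y₁ ⟶ Y₂) (q' : Y₂ ⟶ Y₁) :
    ∃ e : Y₁ ≅ Y₂, e.hom = q := by
  obtain ⟨S, hS⟩ := hfg
  have hinj := ProfiniteGrp.injective_of_surjective S.finite_toSet hS (q ≫ q').map
    (q ≫ q').surjective
  refine exists_iso_of_injective q (fun x y h => hinj (congrArg q'.map h)) fun N => ?_
  exact (q'.sorted _).trans (h₂.sorts_preimage_endo_subset (q' ≫ q).map (q' ≫ q).surjective N)

theorem exists_iso_of_isUniversalSEPCoverIn {𝒞 : ObjectProperty (SortedProfiniteGrp.{u} Jsub)}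
    (h𝒞 : ClosedUnderFiniteQuotients 𝒞) (h𝒞' : ClosedUnderFibreProducts 𝒞)
    (h𝒞'' : ClosedUnderInverseLimits 𝒞) {X : SortedProfiniteGrp.{u} Jsub} (hX : 𝒞 X)
    (hfg : X.IsFinitelyGenerated) {Y₁ Y₂ : SortedProfiniteGrp.{u} Jsub} {p₁ : Y₁ ⟶ X}
    {p₂ : Y₂ ⟶ X} (h₁ : IsUniversalSEPCoverIn 𝒞 p₁) (h₂ : IsUniversalSEPCoverIn 𝒞 p₂) :
    ∃ e : Y₁ ≅ Y₂, e.hom ≫ p₂ = p₁ := by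
  obtain ⟨Y, p, hY, hp⟩ := exists_universalSEPCover h𝒞 h𝒞' h𝒞'' X hX
  obtain ⟨E, e, hE, hEfg⟩ := X.exists_finitelyGenerated_cover hfg
  -- The free cover `E` need not lie in `𝒞`, so universality of `p₁` in `𝒞` cannot be applied to it.
  -- The absolute universal cover `Y`, which lies in `𝒞`, serves as intermediary: `E` maps onto `Y`
  -- and `Y` onto `Y₁`.
  obtain ⟨g, -⟩ := hp.2 E e hE
  obtain ⟨k, -⟩ := h₁.2.2 Y p hY hp.1
  obtain ⟨q, hq⟩ := h₂.2.2 Y₁ p₁ h₁.1 h₁.2.1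
  obtain ⟨q', -⟩ := h₁.2.2 Y₂ p₂ h₂.1 h₂.2.1
  obtain ⟨i, rfl⟩ := exists_iso_of_hom_of_hom h₂.2.1 (hEfg.of_hom (g ≫ k)) q q'
  exact ⟨i, hq⟩

theorem IsUniversalSEPCover.isUniversalSEPCoverIn
    {𝒞 : ObjectProperty (SortedProfiniteGrp.{u} Jsub)} {Y X : SortedProfiniteGrp.{u} Jsub}
    {p : Y ⟶ X} (h : IsUniversalSEPCover p) (hY : 𝒞 Y) : IsUniversalSEPCoverIn 𝒞 p :=
  ⟨hY, h.1, fun Z r _ hZ => h.2 Z r hZ⟩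

end SortedProfiniteGrp

theorem mainTheorem1 {𝒥 : Type v} (Jsub : ℕ → SortTuple 𝒥 → SortTuple 𝒥) :
    (∀ X : SortedProfiniteGrp.{u} Jsub,
      (∃ (Y : SortedProfiniteGrp.{u} Jsub) (p : Y ⟶ X),
        SortedProfiniteGrp.IsUniversalSEPCover p) ∧
      (X.IsFinitelyGenerated →
        ∀ (Y₁ Y₂ : SortedProfiniteGrp.{u} Jsub) (p₁ : Y₁ ⟶ X) (p₂ : Y₂ ⟶ X),
          SortedProfiniteGrp.IsUniversalSEPCover p₁ →
          SortedProfiniteGrp.IsUniversalSEPCover p₂ →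
          ∃ e : Y₁ ≅ Y₂, e.hom ≫ p₂ = p₁)) ∧
    (∀ 𝒞 : ObjectProperty (SortedProfiniteGrp.{u} Jsub),
      SortedProfiniteGrp.ClosedUnderFiniteQuotients 𝒞 →
      SortedProfiniteGrp.ClosedUnderFibreProducts 𝒞 →
      SortedProfiniteGrp.ClosedUnderInverseLimits 𝒞 →
      ∀ X : SortedProfiniteGrp.{u} Jsub, 𝒞 X →
        (∃ (Y : SortedProfiniteGrp.{u} Jsub) (p : Y ⟶ X),
          SortedProfiniteGrp.IsUniversalSEPCover p ∧
          SortedProfiniteGrp.IsUniversalSEPCoverIn 𝒞 p) ∧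
        (X.IsFinitelyGenerated →
          ∀ (Y₁ Y₂ : SortedProfiniteGrp.{u} Jsub) (p₁ : Y₁ ⟶ X) (p₂ : Y₂ ⟶ X),
            SortedProfiniteGrp.IsUniversalSEPCoverIn 𝒞 p₁ →
            SortedProfiniteGrp.IsUniversalSEPCoverIn 𝒞 p₂ →
            ∃ e : Y₁ ≅ Y₂, e.hom ≫ p₂ = p₁)) := by

  have main : ∀ 𝒞 : ObjectProperty (SortedProfiniteGrp.{u} Jsub),
      SortedProfiniteGrp.ClosedUnderFiniteQuotients 𝒞 →
      SortedProfiniteGrp.ClosedUnderFibreProducts 𝒞 →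
      SortedProfiniteGrp.ClosedUnderInverseLimits 𝒞 →
      ∀ X : SortedProfiniteGrp.{u} Jsub, 𝒞 X →
        (∃ (Y : SortedProfiniteGrp.{u} Jsub) (p : Y ⟶ X),
          SortedProfiniteGrp.IsUniversalSEPCover p ∧
          SortedProfiniteGrp.IsUniversalSEPCoverIn 𝒞 p) ∧
        (X.IsFinitelyGenerated →
          ∀ (Y₁ Y₂ : SortedProfiniteGrp.{u} Jsub) (p₁ : Y₁ ⟶ X) (p₂ : Y₂ ⟶ X),
            SortedProfiniteGrp.IsUniversalSEPCoverIn 𝒞 p₁ →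
            SortedProfiniteGrp.IsUniversalSEPCoverIn 𝒞 p₂ →
            ∃ e : Y₁ ≅ Y₂, e.hom ≫ p₂ = p₁) := by
    intro 𝒞 h𝒞 h𝒞' h𝒞'' X hX
    refine ⟨?_, fun hfg Y₁ Y₂ p₁ p₂ h₁ h₂ =>
      SortedProfiniteGrp.exists_iso_of_isUniversalSEPCoverIn h𝒞 h𝒞' h𝒞'' hX hfg h₁ h₂⟩
    obtain ⟨Y, p, hY, hp⟩ := SortedProfiniteGrp.exists_universalSEPCover h𝒞 h𝒞' h𝒞'' X hX
    exact ⟨Y, p, hp, hp.isUniversalSEPCoverIn hY⟩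
  refine ⟨fun X => ?_, main⟩
  -- Part (a) is part (b) for the category of all sorted profinite groups.
  obtain ⟨⟨Y, p, hp, -⟩, huniq⟩ := main ⊤ (fun _ _ _ _ _ => trivial)
    (fun _ _ _ _ _ _ _ _ _ _ _ _ => trivial) (fun _ _ _ _ => ⟨fun _ _ => trivial⟩) X trivial
  exact ⟨⟨Y, p, hp⟩, fun hfg Y₁ Y₂ p₁ p₂ h₁ h₂ => huniq hfg Y₁ Y₂ p₁ p₂
    (h₁.isUniversalSEPCoverIn trivial) (h₂.isUniversalSEPCoverIn trivial)⟩
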